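/- Let $d\ge 3$ and let $(\mathbf S_n)_{n\ge 0}$ be the simple symmetric random walk on $\mathbb Z^d$ started at the origin: $\mathbf S_0=\mathbf 0$, $\mathbf S_n=\sum_{k=1}^n\mathbf X_k$, where the $\mathbf X_k$ are i.i.d. with $\mathbf P(\mathbf X_1=\mathbf e_i)=\frac1{2d}$ for $i=1,\dots,2d$; here $\mathbf e_1,\dots,\mathbf e_d$ are the standard unit vectors and $\mathbf e_{d+j}=-\mathbf e_j$. Let $\xi(\mathbf z,\infty)=\#\{k>0:\mathbf S_k=\mathbf z\}$ be the total local time at $\mathbf z\in\mathbb Z^d$, let $\gamma$ be the probability that the walk never returns to the origin, let $\alpha=\frac{1-\gamma}{2-\gamma}$, and let (with the convention $0\log 0=0$) $$\mathcal B=\{(x,y):\ x\ge 0,\ y\ge 0,\ -(x+y)\log(x+y)+x\log x+y\log y-(x+y)\log\alpha\le 1\}.$$ For each $\varepsilon>0$, with probability 1 there exists an $n_0$ such that for all $n\ge n_0$: (i) for all $j=0,1,\dots,n$ and all $i=1,\dots,2d$, both local times below are finite and $$(\xi(\mathbf S_j,\infty),\,\xi(\mathbf S_j+\mathbf e_i,\infty))\in((1+\varepsilon)\log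 n)\,\mathcal B;$$ (ii) for every pair $(k,\ell)$ of non-negative integers with $(k,\ell)\in((1-\varepsilon)\log n)\,\mathcal B$ and every $i\in\{1,\dots,2d\}$ there exists an integer $j$ with $0\le j\le n$ for which $$(\xi(\mathbf S_j,\infty),\,\xi(\mathbf S_j+\mathbf e_i,\infty))=(k+1,\ell).$$ -/

import Mathlib

open MeasureTheory ProbabilityTheory
open scoped Pointwise ENNReal

noncomputable section

namespace LatticeWalk

/-- The `2d` signed unit vectors of `ℤ^d`: `e_1, …, e_d` on the left summand and
`e_{d+j} = -e_j` on the right summand. -/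
def unitStep (d : ℕ) : Fin d ⊕ Fin d → (Fin d → ℤ)
  | Sum.inl j => Pi.single j 1
  | Sum.inr j => -Pi.single j 1

/-- `X` is the step sequence of a simple symmetric random walk on `ℤ^d`: independent random
vectors, each uniformly distributed on the `2d` signed unit vectors.
Here `X k` is the `(k+1)`-st step. -/
structure IsSimpleSteps {Ω : Type*} [MeasurableSpace Ω] (d : ℕ) (μ : Measure Ω)
    (X : ℕ → Ω → (Fin d → ℤ)) : Prop where
  measurable : ∀ k, Measurable (X k)
  indep : iIndepFun X μ
  law : ∀ k i, μ {ω | X k ω = unitStep d i} = 1 / (2 * (d : ℝ≥0∞))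

/-- The position `S_n` of the walk started at the origin, after `n` steps. -/
def walk {Ω : Type*} {d : ℕ} (X : ℕ → Ω → (Fin d → ℤ)) (n : ℕ) (ω : Ω) : Fin d → ℤ :=
  ∑ k ∈ Finset.range n, X k ω

/-- The total local time `ξ(z,∞) = #{k > 0 : S_k = z}`, possibly infinite. -/
def totalLocalTime {Ω : Type*} {d : ℕ} (X : ℕ → Ω → (Fin d → ℤ)) (z : Fin d → ℤ) (ω : Ω) : ℕ∞ :=
  Set.encard {k : ℕ | 0 < k ∧ walk X k ω = z}

/-- `γ`: the probability that the walk never returns to the origin. -/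
def escapeProb {Ω : Type*} [MeasurableSpace Ω] {d : ℕ} (μ : Measure Ω)
    (X : ℕ → Ω → (Fin d → ℤ)) : ℝ :=
  μ.real {ω | ∀ k : ℕ, 0 < k → walk X k ω ≠ 0}

/-- The planar region `𝓑` belonging to the escape probability `γ`, with `α = (1-γ)/(2-γ)`.
The convention `0 log 0 = 0` is automatic. -/
def regionB (γ : ℝ) : Set (ℝ × ℝ) :=
  {p | 0 ≤ p.1 ∧ 0 ≤ p.2 ∧
    -(p.1 + p.2) * Real.log (p.1 + p.2) + p.1 * Real.log p.1 + p.2 * Real.log p.2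
      - (p.1 + p.2) * Real.log ((1 - γ) / (2 - γ)) ≤ 1}

end LatticeWalk

end

namespace LatticeWalk

/-! Fix a unit vector `e` and watch only the visits to `{0, e}`. A first-step argument and the
lattice symmetries show that a neighbour is hit with the same probability `1 - γ` as the origin is
returned to. Decomposing both hitting events at the first visit to `{0, e}` gives two linear
equations, whose solution says that from either site the next visit is at `0` or at `e` with
probability `α = (1-γ)/(2-γ)` each, and that no visit follows with probability `1 - 2α > 0`. The
counts of visits therefore behave like a killed sequence of fair coin tosses: reaching `(k, l)`
costs at most `C(k+l, k) α^(k+l)` (`measure_reached_le`), and ending there has at least `1 - 2α`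
times that probability (`le_measure_total`). Up to polynomial factors this weight is `exp (-pairRate
α k l)`, and `pairRate` is homogeneous of degree one, so `c • 𝓑` is the part of the quadrant where
the rate is at most `c`. At scale `log n` the rate becomes a power of `n`.

Upper bound (`ae_localTime_rate_le`): each pair of sites may be examined at the time the walk first
meets it. A pair with rate above `(1+ε) log j` then has probability of order `j^(-1-ε/2)`, and
Borel–Cantelli applies.

Lower bound (`ae_exists_localTimes`): the time up to `n` contains many disjoint, independent blocks.
In each one, the middle site is new within the block and collects exactly the counts `(k, l)` with
probability comparable to the weight (`le_measure_success`; the past is handled by time reversal).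
Visits from outside the block spoil this only with probability a small multiple of the weight
(`measure_spoiled_le`), because visits after time `s` have probability `O(s^(-1/4))`, a consequence
of the heat kernel bound `exists_measure_pos_le`. Borel–Cantelli along `n = 2^M` and interpolation
finish the argument. -/

instance discreteMeasurableSpace_sum {α β : Type*} [MeasurableSpace α] [MeasurableSpace β]
    [DiscreteMeasurableSpace α] [DiscreteMeasurableSpace β] : DiscreteMeasurableSpace (α ⊕ β) :=
  ⟨fun _ => measurableSet_sum_iff.2 ⟨.of_discrete, .of_discrete⟩⟩

/-! ### Canonical path space of step labels -/

/-- The uniform distribution on the `2d` step labels. -/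
noncomputable def stepLaw (d : ℕ) : Measure (Fin d ⊕ Fin d) :=
  (2 * (d : ℝ≥0∞))⁻¹ • Measure.count

instance stepLaw_isProbabilityMeasure (d : ℕ) [NeZero d] : IsProbabilityMeasure (stepLaw d) := by
  constructor
  have h0 : (2 * (d : ℝ≥0∞)) ≠ 0 := by simp [NeZero.ne d]
  have h1 : (2 * (d : ℝ≥0∞)) ≠ ∞ := ENNReal.mul_ne_top (by simp) (by simp)
  rw [stepLaw, Measure.smul_apply, Measure.count_univ]
  simp only [ENat.card_eq_coe_fintype_card, Fintype.card_sum, Fintype.card_fin, smul_eq_mul]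
  rw [show ((d + d : ℕ) : ℕ∞) = ((2 * d : ℕ) : ℕ∞) by rw [two_mul]]
  simpa using ENNReal.inv_mul_cancel h0 h1

/-- The law of an infinite sequence of independent uniform step labels. -/
noncomputable def pathLaw (d : ℕ) [NeZero d] : Measure (ℕ → Fin d ⊕ Fin d) :=
  Measure.infinitePi fun _ => stepLaw d

instance pathLaw_isProbabilityMeasure (d : ℕ) [NeZero d] : IsProbabilityMeasure (pathLaw d) := by
  unfold pathLaw; infer_instance

variable {d : ℕ}

/-- The position after `n` steps of the path with step labels `x`. -/
def pos (x : ℕ → Fin d ⊕ Fin d) (n : ℕ) : Fin d → ℤ :=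
  ∑ k ∈ Finset.range n, unitStep d (x k)

/-- The step labels from time `N` on. -/
def shift (N : ℕ) (x : ℕ → Fin d ⊕ Fin d) : ℕ → Fin d ⊕ Fin d := fun k => x (N + k)

@[simp] lemma pos_zero (x : ℕ → Fin d ⊕ Fin d) : pos x 0 = 0 := by simp [pos]

lemma pos_succ (x : ℕ → Fin d ⊕ Fin d) (n : ℕ) : pos x (n + 1) = pos x n + unitStep d (x n) := by
  simp [pos, Finset.sum_range_succ]

lemma pos_add (x : ℕ → Fin d ⊕ Fin d) (N m : ℕ) :
    pos x (N + m) = pos x N + pos (shift N x) m := by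
  simp [pos, shift, Finset.sum_range_add]

@[simp] lemma shift_shift (M N : ℕ) (x : ℕ → Fin d ⊕ Fin d) :
    shift M (shift N x) = shift (N + M) x := by
  ext k; simp [shift, add_assoc]

@[fun_prop] lemma measurable_shift (N : ℕ) :
    Measurable (shift N : (ℕ → Fin d ⊕ Fin d) → ℕ → Fin d ⊕ Fin d) :=
  measurable_pi_lambda _ fun _ => measurable_pi_apply _

@[fun_prop] lemma measurable_pos (n : ℕ) :
    Measurable fun x : ℕ → Fin d ⊕ Fin d => pos x n := by
  refine Finset.measurable_sum _ fun k _ => ?_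
  exact (Measurable.of_discrete (f := unitStep d)).comp (measurable_pi_apply k)

/-- The event `B` depends only on the first `N` step labels. -/
def DeterminedBy (N : ℕ) (B : Set (ℕ → Fin d ⊕ Fin d)) : Prop :=
  ∀ x y, (∀ k < N, x k = y k) → x ∈ B → y ∈ B

lemma pos_congr {x y : ℕ → Fin d ⊕ Fin d} {N n : ℕ} (h : ∀ k < N, x k = y k) (hn : n ≤ N) :
    pos x n = pos y n :=
  Finset.sum_congr rfl fun k hk => by rw [h k ((Finset.mem_range.1 hk).trans_le hn)]

lemma DeterminedBy.eq_preimage {N : ℕ} {B : Set (ℕ → Fin d ⊕ Fin d)} (hB : DeterminedBy N B) :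
    B = (fun x (k : Fin N) => x k) ⁻¹' ((fun x (k : Fin N) => x k) '' B) := by
  ext x
  refine ⟨fun hx => ⟨x, hx, rfl⟩, ?_⟩
  rintro ⟨y, hy, hxy⟩
  exact hB y x (fun k hk => congrFun hxy ⟨k, hk⟩) hy

lemma DeterminedBy.measurableSet {N : ℕ} {B : Set (ℕ → Fin d ⊕ Fin d)} (hB : DeterminedBy N B) :
    MeasurableSet B := by
  rw [hB.eq_preimage]
  exact measurableSet_preimage (measurable_pi_lambda _ fun _ => measurable_pi_apply _)
    (Set.toFinite _).measurableSet

lemma DeterminedBy.mono {M N : ℕ} (h : M ≤ N) {B : Set (ℕ → Fin d ⊕ Fin d)}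
    (hB : DeterminedBy M B) : DeterminedBy N B :=
  fun x y hxy hx => hB x y (fun k hk => hxy k (hk.trans_le h)) hx

lemma DeterminedBy.inter {N : ℕ} {A B : Set (ℕ → Fin d ⊕ Fin d)}
    (hA : DeterminedBy N A) (hB : DeterminedBy N B) : DeterminedBy N (A ∩ B) :=
  fun x y hxy hx => ⟨hA x y hxy hx.1, hB x y hxy hx.2⟩

lemma DeterminedBy.compl {N : ℕ} {B : Set (ℕ → Fin d ⊕ Fin d)}
    (hB : DeterminedBy N B) : DeterminedBy N Bᶜ :=
  fun x y hxy hx hy => hx (hB y x (fun k hk => (hxy k hk).symm) hy)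

lemma DeterminedBy.shift_preimage {M : ℕ} (N : ℕ) {B : Set (ℕ → Fin d ⊕ Fin d)}
    (hB : DeterminedBy M B) : DeterminedBy (N + M) (shift N ⁻¹' B) :=
  fun x y hxy hx => hB (shift N x) (shift N y) (fun k hk => hxy (N + k) (by omega)) hx

/-! ### Invariances of the path law, independence of past and future -/

section Law

variable [NeZero d]

lemma map_reindex_pathLaw {g : ℕ → ℕ} (hg : Function.Injective g) :
    (pathLaw d).map (fun x n => x (g n)) = pathLaw d :=
  Measure.map_infinitePi_infinitePi_of_inj hg

lemma measure_reindex_preimage {g : ℕ → ℕ} (hg : Function.Injective g)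
    {A : Set (ℕ → Fin d ⊕ Fin d)} (hA : MeasurableSet A) :
    (pathLaw d).real ((fun x n => x (g n)) ⁻¹' A) = (pathLaw d).real A := by
  conv_rhs => rw [← map_reindex_pathLaw hg]
  rw [map_measureReal_apply (by fun_prop) hA]

lemma measure_shift_preimage (N : ℕ) {A : Set (ℕ → Fin d ⊕ Fin d)} (hA : MeasurableSet A) :
    (pathLaw d).real (shift N ⁻¹' A) = (pathLaw d).real A :=
  measure_reindex_preimage (add_right_injective N) hA

/-- Source of all lattice symmetries: relabelling the steps preserves the uniform law in each
coordinate. -/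
lemma measure_perm_preimage (τ : Equiv.Perm (Fin d ⊕ Fin d))
    {A : Set (ℕ → Fin d ⊕ Fin d)} (hA : MeasurableSet A) :
    (pathLaw d).real ((fun x n => τ (x n)) ⁻¹' A) = (pathLaw d).real A := by
  have h : (pathLaw d).map (fun x n => τ (x n)) = pathLaw d := by
    have h1 : (stepLaw d).map τ = stepLaw d := by
      refine Measure.ext fun s _ => ?_
      rw [Measure.map_apply .of_discrete .of_discrete, stepLaw, Measure.smul_apply,
        Measure.smul_apply, Measure.count_apply .of_discrete, Measure.count_apply .of_discrete,
        Set.encard_preimage_of_bijective τ.bijective]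
    rw [pathLaw, Measure.infinitePi_map_pi _ (f := fun _ => τ) fun _ => .of_discrete]
    simp only [h1]
  conv_rhs => rw [← h]
  have hm : Measurable fun (x : ℕ → Fin d ⊕ Fin d) n => τ (x n) :=
    measurable_pi_lambda _ fun n => (Measurable.of_discrete (f := τ)).comp (measurable_pi_apply n)
  rw [map_measureReal_apply hm hA]

lemma measurable_pi_of_comap_le {α δ β : Type*} [MeasurableSpace β] {m : MeasurableSpace α}
    {f : α → δ → β} (h : ∀ k, MeasurableSpace.comap (fun x => f x k) inferInstance ≤ m) :
    Measurable[m] f :=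
  measurable_pi_lambda _ fun k => Measurable.of_comap_le (h k)

/-- The past and the future of a path are independent. -/
lemma measure_inter_shift_preimage {N : ℕ} {A B : Set (ℕ → Fin d ⊕ Fin d)}
    (hB : DeterminedBy N B) (hA : MeasurableSet A) :
    (pathLaw d).real (B ∩ shift N ⁻¹' A) = (pathLaw d).real B * (pathLaw d).real A := by
  have hind : iIndepFun (fun k (x : ℕ → Fin d ⊕ Fin d) => x k) (pathLaw d) :=
    iIndepFun_infinitePi (X := fun _ a => a) fun _ => measurable_id
  have h := indep_iSup_of_disjoint (fun k => (measurable_pi_apply k).comap_le) hind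
    (S := {k | k < N}) (T := {k | N ≤ k})
    (Set.disjoint_left.2 fun k hk hk' => absurd (show _ < N from hk) (not_lt.2 hk'))
  rw [Indep_iff] at h
  have key := h B (shift N ⁻¹' A) ?_ ?_
  · rw [measureReal_def, key, ENNReal.toReal_mul, ← measureReal_def, ← measureReal_def,
      measure_shift_preimage N hA]
  · rw [hB.eq_preimage]
    exact measurable_pi_of_comap_le (fun k : Fin N => le_iSup₂_of_le (k : ℕ) k.2 le_rfl)
      (Set.toFinite _).measurableSet
  · exact measurable_pi_of_comap_le
      (fun k => le_iSup₂_of_le (N + k) (Nat.le_add_right N k) le_rfl) hA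

lemma unitStep_injective (d : ℕ) : Function.Injective (unitStep d) := by
  have h1 : ∀ i j : Fin d, (Pi.single i 1 : Fin d → ℤ) = Pi.single j 1 → i = j := fun i j h => by
    by_contra hij
    have := congrFun h i
    simp [hij] at this
  have h2 : ∀ i j : Fin d, (Pi.single i 1 : Fin d → ℤ) ≠ -Pi.single j 1 := fun i j h => by
    have := congrFun h i
    rcases eq_or_ne i j with rfl | hij
    · simp at this
    · simp [hij] at this
  rintro (i | i) (j | j) h
  · rw [h1 i j h]
  · exact absurd h (h2 i j)
  · exact absurd h.symm (h2 j i)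
  · rw [h1 i j (neg_injective h)]

lemma map_unitStep_eq {Ω : Type*} [MeasurableSpace Ω] {μ : Measure Ω} [IsProbabilityMeasure μ]
    {X : ℕ → Ω → Fin d → ℤ} (hX : IsSimpleSteps d μ X) (k : ℕ) :
    μ.map (X k) = (stepLaw d).map (unitStep d) := by
  have := Measure.isProbabilityMeasure_map (μ := μ) (hX.measurable k).aemeasurable
  have := Measure.isProbabilityMeasure_map (μ := stepLaw d) (f := unitStep d)
    (Measurable.of_discrete.aemeasurable)
  have hsing : ∀ i, μ.map (X k) {unitStep d i} = (2 * (d : ℝ≥0∞))⁻¹ := fun i => by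
    rw [Measure.map_apply (hX.measurable k) (MeasurableSet.singleton _)]
    have h := hX.law k i
    rw [one_div] at h
    exact h
  have hrange : ∀ s : Set (Fin d ⊕ Fin d),
      μ.map (X k) (unitStep d '' s) = stepLaw d s := fun s => by
    have h1 : unitStep d '' s = ⋃ i ∈ s, {unitStep d i} := by ext; simp [eq_comm]
    have h2 : s = ⋃ i ∈ s, {i} := (Set.biUnion_of_singleton s).symm
    rw [h1, measure_biUnion (Set.toFinite s).countable]
    · conv_rhs => rw [h2]
      rw [measure_biUnion (Set.toFinite s).countable]
      · simp [hsing, stepLaw]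
      · intro i _ j _ hij; simpa using hij
      · intros; exact MeasurableSet.singleton _
    · intro i _ j _ hij
      simpa [Function.onFun] using (unitStep_injective d).ne hij
    · intros; exact MeasurableSet.singleton _
  -- The `2d` unit vectors already carry total mass one, so nothing is left for other values of the
  -- step.
  have hnull : μ.map (X k) (Set.range (unitStep d))ᶜ = 0 := by
    rw [prob_compl_eq_zero_iff (Set.toFinite _).measurableSet, ← Set.image_univ, hrange,
      measure_univ]
  refine Measure.ext fun s hs => ?_
  rw [Measure.map_apply (μ := stepLaw d) .of_discrete hs, ← hrange, Set.image_preimage_eq_inter_range,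
    measure_inter_conull hnull]

/-- The step sequence of the walk has the law of the canonical step sequence. -/
lemma map_steps_eq {Ω : Type*} [MeasurableSpace Ω] {μ : Measure Ω} [IsProbabilityMeasure μ]
    {X : ℕ → Ω → Fin d → ℤ} (hX : IsSimpleSteps d μ X) :
    μ.map (fun ω k => X k ω) = (pathLaw d).map fun x k => unitStep d (x k) := by
  rw [(iIndepFun_iff_map_fun_eq_infinitePi_map hX.measurable).1 hX.indep, pathLaw,
    Measure.infinitePi_map_pi _ (f := fun _ => unitStep d) fun _ => .of_discrete]
  simp only [map_unitStep_eq hX]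

end Law

/-! ### Fourier analysis of the transition probabilities -/

section HeatKernel

variable {d : ℕ}

lemma measure_first_step [NeZero d] (i : Fin d ⊕ Fin d) :
    (pathLaw d).real {x | x 0 = i} = 1 / (2 * d) := by
  have h : (pathLaw d).real {x | x 0 = i} = (stepLaw d).real {i} := by
    conv_rhs => rw [← Measure.infinitePi_map_eval (fun _ : ℕ => stepLaw d) 0]
    rw [map_measureReal_apply (by fun_prop) (MeasurableSet.singleton _)]
    rfl
  rw [h, stepLaw, measureReal_def]
  simp

lemma measurableSet_pos_eq (n : ℕ) (z : Fin d → ℤ) : MeasurableSet {x | pos x n = z} :=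
  measurable_pos n (MeasurableSet.singleton z)

/-- First-step decomposition of an event. -/
lemma measure_eq_sum_first_step [NeZero d] {B : Set (ℕ → Fin d ⊕ Fin d)}
    {A : Fin d ⊕ Fin d → Set (ℕ → Fin d ⊕ Fin d)} (hA : ∀ i, MeasurableSet (A i))
    (h : ∀ x, x ∈ B ↔ shift 1 x ∈ A (x 0)) :
    (pathLaw d).real B = 1 / (2 * d) * ∑ i, (pathLaw d).real (A i) := by
  have hB : B = ⋃ i ∈ Finset.univ, ({x | x 0 = i} ∩ shift 1 ⁻¹' A i) := by
    ext x; simp [h]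
  have hdet : ∀ i, DeterminedBy 1 {x : ℕ → Fin d ⊕ Fin d | x 0 = i} := fun i x y hxy hx => by
    rw [Set.mem_ofPred_eq, ← hxy 0 one_pos]; exact hx
  rw [hB, measureReal_biUnion_finset, Finset.mul_sum]
  · refine Finset.sum_congr rfl fun i _ => ?_
    rw [measure_inter_shift_preimage (hdet i) (hA i), measure_first_step]
  · intro i _ j _ hij
    rw [Function.onFun, Set.disjoint_left]
    exact fun x hx hx' => hij (hx.1.symm.trans hx'.1)
  · exact fun i _ => (hdet i).measurableSet.inter (measurable_shift 1 (hA i))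

lemma measure_pos_succ [NeZero d] (n : ℕ) (z : Fin d → ℤ) :
    (pathLaw d).real {x | pos x (n + 1) = z} =
      1 / (2 * d) * ∑ i, (pathLaw d).real {x | pos x n = z - unitStep d i} := by
  refine measure_eq_sum_first_step (fun i => measurableSet_pos_eq n _) fun x => ?_
  rw [Set.mem_ofPred_eq, Set.mem_ofPred_eq, add_comm n 1, pos_add, eq_sub_iff_add_eq, add_comm]
  simp [pos]

/-- The characteristic function of a single step. -/
noncomputable def stepChar (θ : Fin d → ℝ) : ℝ := 1 / d * ∑ j, Real.cos (θ j)

/-- Lebesgue measure on the cube `(-π, π]^d`. -/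
noncomputable def cubeMeasure (d : ℕ) : Measure (Fin d → ℝ) :=
  Measure.pi fun _ => volume.restrict (Set.Ioc (-Real.pi) Real.pi)

instance cubeMeasure_isFiniteMeasure : IsFiniteMeasure (cubeMeasure d) := by
  unfold cubeMeasure; infer_instance

lemma continuous_stepChar : Continuous (stepChar (d := d)) := by
  unfold stepChar; fun_prop

lemma abs_stepChar_le_one (θ : Fin d → ℝ) : |stepChar θ| ≤ 1 := by
  rcases Nat.eq_zero_or_pos d with rfl | hd
  · simp [stepChar]
  have hd' : (0 : ℝ) < d := Nat.cast_pos.2 hd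
  rw [stepChar, abs_mul, abs_of_pos (by positivity), one_div, inv_mul_le_iff₀ hd', mul_one]
  calc |∑ j, Real.cos (θ j)| ≤ ∑ j, |Real.cos (θ j)| := Finset.abs_sum_le_sum_abs _ _
    _ ≤ ∑ _j : Fin d, (1 : ℝ) := Finset.sum_le_sum fun j _ => Real.abs_cos_le_one _
    _ = d := by simp

lemma integral_exp_int (k : ℤ) :
    ∫ t in Set.Ioc (-Real.pi) Real.pi, Complex.exp (Complex.I * k * t) =
      if k = 0 then ((2 * Real.pi : ℝ) : ℂ) else 0 := by
  rw [← intervalIntegral.integral_of_le (by linarith [Real.pi_pos])]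
  split_ifs with hk
  · subst hk; simp; ring
  · have hc : Complex.I * (k : ℂ) ≠ 0 := mul_ne_zero Complex.I_ne_zero (by exact_mod_cast hk)
    rw [integral_exp_mul_complex hc, div_eq_zero_iff]
    left
    rw [sub_eq_zero, Complex.exp_eq_exp_iff_exists_int]
    exact ⟨k, by push_cast; ring⟩

lemma integral_cos_cube (z : Fin d → ℤ) :
    ∫ θ, Real.cos (∑ j, θ j * z j) ∂(cubeMeasure d) =
      if z = 0 then (2 * Real.pi) ^ d else 0 := by
  have h1 : ∫ θ : Fin d → ℝ, ∏ j, Complex.exp (Complex.I * z j * θ j) ∂(cubeMeasure d) =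
      if z = 0 then (((2 * Real.pi) ^ d : ℝ) : ℂ) else 0 := by
    rw [cubeMeasure, integral_fintype_prod_eq_prod
      (f := fun j (t : ℝ) => Complex.exp (Complex.I * z j * t))]
    simp_rw [integral_exp_int]
    split_ifs with hz
    · subst hz; simp
    · obtain ⟨j, hj⟩ := Function.ne_iff.1 hz
      exact Finset.prod_eq_zero (Finset.mem_univ j) (if_neg hj)
  have h2 : ∀ θ : Fin d → ℝ, Real.cos (∑ j, θ j * z j) =
      RCLike.re (∏ j, Complex.exp (Complex.I * z j * θ j)) := fun θ => by
    rw [← Complex.exp_sum, ← Complex.exp_ofReal_mul_I_re]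
    congr 2
    push_cast
    rw [Finset.sum_mul]
    exact Finset.sum_congr rfl fun j _ => by ring
  simp_rw [h2]
  rw [integral_re, h1]
  · split_ifs
    · exact Complex.ofReal_re _
    · simp
  · refine Integrable.of_bound (C := 1) (Continuous.aestronglyMeasurable (by fun_prop)) ?_
    refine Filter.Eventually.of_forall fun θ => le_of_eq ?_
    rw [norm_prod]
    refine Finset.prod_eq_one fun j _ => ?_
    rw [show Complex.I * z j * θ j = ((z j * θ j : ℝ) : ℂ) * Complex.I by push_cast; ring]
    exact Complex.norm_exp_ofReal_mul_I _

lemma integrable_cos_mul_stepChar_pow (z : Fin d → ℤ) (n : ℕ) :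
    Integrable (fun θ => Real.cos (∑ j, θ j * z j) * stepChar θ ^ n) (cubeMeasure d) := by
  have := continuous_stepChar (d := d)
  refine Integrable.of_bound (C := 1) (Continuous.aestronglyMeasurable (by fun_prop)) ?_
  refine Filter.Eventually.of_forall fun θ => ?_
  rw [norm_mul, norm_pow]
  exact mul_le_one₀ (Real.abs_cos_le_one _) (by positivity)
    (pow_le_one₀ (norm_nonneg _) (abs_stepChar_le_one θ))

/-- Plane waves are eigenfunctions of the transition operator: the addition formula applied to each
pair of opposite steps yields the eigenvalue `stepChar θ`. -/
lemma sum_cos_sub_unitStep [NeZero d] (θ : Fin d → ℝ) (z : Fin d → ℤ) :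
    1 / (2 * (d : ℝ)) * ∑ i, Real.cos (∑ j, θ j * ((z - unitStep d i) j : ℤ)) =
      Real.cos (∑ j, θ j * z j) * stepChar θ := by
  have hsingle : ∀ k : Fin d, ∑ j, θ j * ((Pi.single k 1 : Fin d → ℤ) j : ℝ) = θ k := fun k => by
    rw [Finset.sum_eq_single k]
    · simp
    · intro j _ hj; simp [hj]
    · simp
  rw [Fintype.sum_sum_type, ← Finset.sum_add_distrib, stepChar]
  have h : ∀ k : Fin d, Real.cos (∑ j, θ j * ((z - unitStep d (Sum.inl k)) j : ℤ)) +
      Real.cos (∑ j, θ j * ((z - unitStep d (Sum.inr k)) j : ℤ)) =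
      2 * Real.cos (∑ j, θ j * z j) * Real.cos (θ k) := fun k => by
    simp only [unitStep, Pi.sub_apply, Pi.neg_apply, Int.cast_sub, Int.cast_neg, mul_sub, mul_neg,
      Finset.sum_sub_distrib, Finset.sum_neg_distrib, hsingle, Real.cos_sub, Real.cos_neg,
      Real.sin_neg]
    ring
  simp_rw [h]
  rw [← Finset.mul_sum]
  have : (d : ℝ) ≠ 0 := Nat.cast_ne_zero.2 (NeZero.ne d)
  field_simp

/-- Fourier inversion for the transition probabilities of the walk. -/
lemma measure_pos_eq_integral [NeZero d] (n : ℕ) (z : Fin d → ℤ) :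
    (2 * Real.pi) ^ d * (pathLaw d).real {x | pos x n = z} =
      ∫ θ, Real.cos (∑ j, θ j * z j) * stepChar θ ^ n ∂(cubeMeasure d) := by
  induction n generalizing z with
  | zero =>
    simp only [pow_zero, mul_one, pos_zero]
    rw [integral_cos_cube]
    split_ifs with hz
    · subst hz; simp
    · have : {x : ℕ → Fin d ⊕ Fin d | (0 : Fin d → ℤ) = z} = ∅ := by
        ext x; simpa using fun h => hz h.symm
      rw [this]; simp
  | succ n ih =>
    rw [measure_pos_succ, mul_left_comm, Finset.mul_sum]
    simp_rw [ih]
    rw [← integral_finsetSum _ fun i _ => integrable_cos_mul_stepChar_pow _ n,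
      ← integral_const_mul]
    congr 1 with θ
    rw [← Finset.sum_mul, ← mul_assoc, sum_cos_sub_unitStep, pow_succ]
    ring

/-- On `[-π, π]` one has `1 - cos t ≥ 2 t² / π²`, which leaves a Gaussian integral. -/
lemma integral_exp_cos_le {a : ℝ} (ha : 0 < a) :
    ∫ t in Set.Ioc (-Real.pi) Real.pi, Real.exp (-a * (1 - Real.cos t)) ≤
      Real.sqrt (Real.pi ^ 3 / (2 * a)) := by
  have hb : 0 < a * (2 / Real.pi ^ 2) := by positivity
  calc ∫ t in Set.Ioc (-Real.pi) Real.pi, Real.exp (-a * (1 - Real.cos t))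
      ≤ ∫ t in Set.Ioc (-Real.pi) Real.pi, Real.exp (-(a * (2 / Real.pi ^ 2)) * t ^ 2) := by
        refine setIntegral_mono_on ?_ (integrable_exp_neg_mul_sq hb).integrableOn
          measurableSet_Ioc fun t ht => ?_
        · exact (Continuous.integrableOn_Ioc (by fun_prop))
        · have := Real.cos_le_one_sub_mul_cos_sq (x := t) (abs_le.2 ⟨ht.1.le, ht.2⟩)
          refine Real.exp_le_exp.2 ?_
          nlinarith
    _ ≤ ∫ t, Real.exp (-(a * (2 / Real.pi ^ 2)) * t ^ 2) :=
        setIntegral_le_integral (integrable_exp_neg_mul_sq hb)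
          (Filter.Eventually.of_forall fun t => (Real.exp_pos _).le)
    _ = Real.sqrt (Real.pi ^ 3 / (2 * a)) := by
        rw [integral_gaussian]
        congr 1
        field_simp

/-- A shift by half a period changes the sign of the cosine. -/
lemma integral_exp_neg_cos_eq (a : ℝ) :
    ∫ t in Set.Ioc (-Real.pi) Real.pi, Real.exp (-a * (1 + Real.cos t)) =
      ∫ t in Set.Ioc (-Real.pi) Real.pi, Real.exp (-a * (1 - Real.cos t)) := by
  have hle : -Real.pi ≤ Real.pi := by linarith [Real.pi_pos]
  rw [← intervalIntegral.integral_of_le hle, ← intervalIntegral.integral_of_le hle]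
  have hper : Function.Periodic (fun t => Real.exp (-a * (1 - Real.cos t))) (2 * Real.pi) :=
    fun t => by simp only [Real.cos_add_two_pi]
  have h := hper.intervalIntegral_add_eq (-Real.pi) 0
  rw [show -Real.pi + 2 * Real.pi = Real.pi by ring, zero_add] at h
  rw [h]
  have h2 := intervalIntegral.integral_comp_add_right (a := -Real.pi) (b := Real.pi)
    (fun t => Real.exp (-a * (1 - Real.cos t))) Real.pi
  rw [neg_add_cancel, ← two_mul] at h2
  rw [← h2]
  simp [Real.cos_add_pi]

/-- From `|y| ≤ exp (|y| - 1)`. Both signs are needed since the walk has period two: its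
characteristic function comes close to `-1` as well as to `1`. -/
lemma abs_pow_le_exp_add_exp (y : ℝ) (n : ℕ) :
    |y| ^ n ≤ Real.exp (-n * (1 - y)) + Real.exp (-n * (1 + y)) := by
  have h : |y| ^ n ≤ Real.exp (n * (|y| - 1)) := by
    rw [Real.exp_nat_mul]
    exact pow_le_pow_left₀ (abs_nonneg _) (by linarith [Real.add_one_le_exp (|y| - 1)]) n
  rcases abs_cases y with ⟨hy, _⟩ | ⟨hy, _⟩
  · rw [hy] at h ⊢
    rw [show (n : ℝ) * (y - 1) = -n * (1 - y) by ring] at h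
    linarith [Real.exp_pos (-n * (1 + y))]
  · rw [hy] at h ⊢
    rw [show (n : ℝ) * (-y - 1) = -n * (1 + y) by ring] at h
    linarith [Real.exp_pos (-n * (1 - y))]

/-- The exponent is a sum over the coordinates, so the integral factorizes into `d` one-dimensional
ones. -/
lemma integral_exp_stepChar_le [NeZero d] {n : ℕ} (hn : 0 < n) {σ : ℝ} (hσ : σ = 1 ∨ σ = -1) :
    ∫ θ, Real.exp (-n * (1 - σ * stepChar θ)) ∂(cubeMeasure d) ≤
      Real.sqrt (Real.pi ^ 3 * d / (2 * n)) ^ d := by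
  have hd : (0 : ℝ) < d := Nat.cast_pos.2 (NeZero.pos d)
  have hn' : (0 : ℝ) < n := Nat.cast_pos.2 hn
  have h : ∀ θ : Fin d → ℝ, Real.exp (-n * (1 - σ * stepChar θ)) =
      ∏ j, Real.exp (-(n / d) * (1 - σ * Real.cos (θ j))) := fun θ => by
    rw [← Real.exp_sum, ← Finset.mul_sum, Finset.sum_sub_distrib, ← Finset.mul_sum, stepChar]
    congr 1
    simp only [Finset.sum_const, Finset.card_univ, Fintype.card_fin, nsmul_eq_mul, mul_one]
    field_simp
  simp_rw [h]
  rw [cubeMeasure, integral_fintype_prod_eq_prod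
    (f := fun _ t => Real.exp (-((n : ℝ) / d) * (1 - σ * Real.cos t))), Finset.prod_const,
    Finset.card_univ, Fintype.card_fin]
  refine pow_le_pow_left₀ (integral_nonneg fun t => (Real.exp_pos _).le) ?_ d
  have key := integral_exp_cos_le (a := (n : ℝ) / d) (by positivity)
  rw [show Real.pi ^ 3 / (2 * ((n : ℝ) / d)) = Real.pi ^ 3 * d / (2 * n) by field_simp] at key
  rcases hσ with rfl | rfl
  · simpa only [one_mul] using key
  · rw [← integral_exp_neg_cos_eq] at key
    simpa only [neg_mul, one_mul, sub_neg_eq_add] using key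

/-- In dimension at least three, the transition probabilities decay like `n ^ (-3/2)`. -/
theorem exists_measure_pos_le [NeZero d] (hd : 3 ≤ d) :
    ∃ C : ℝ, 0 < C ∧ ∀ (n : ℕ) (z : Fin d → ℤ), 0 < n →
      (pathLaw d).real {x | pos x n = z} ≤ C * (n : ℝ) ^ (-(3 / 2) : ℝ) := by
  have hd' : (0 : ℝ) < d := Nat.cast_pos.2 (NeZero.pos d)
  set K := Real.sqrt (Real.pi ^ 3 * d / 2) with hK
  have hKpos : 0 < K := Real.sqrt_pos.2 (by have := Real.pi_pos; positivity)
  refine ⟨2 * K ^ d / (2 * Real.pi) ^ d, by have := Real.pi_pos; positivity, fun n z hn => ?_⟩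
  have hn' : (0 : ℝ) < n := Nat.cast_pos.2 hn
  have hpi : 0 < (2 * Real.pi) ^ d := by have := Real.pi_pos; positivity
  have hc := continuous_stepChar (d := d)
  have hint : ∀ σ : ℝ, Integrable (fun θ => Real.exp (-n * (1 - σ * stepChar θ)))
      (cubeMeasure d) := fun σ => by
    refine Integrable.of_bound (C := Real.exp (n * |σ|))
      (Continuous.aestronglyMeasurable (by fun_prop)) ?_
    refine Filter.Eventually.of_forall fun θ => ?_
    rw [Real.norm_eq_abs, Real.abs_exp]
    refine Real.exp_le_exp.2 ?_
    have h1 : σ * stepChar θ ≤ |σ| :=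
      (le_abs_self _).trans ((abs_mul _ _).trans_le
        (mul_le_of_le_one_right (abs_nonneg _) (abs_stepChar_le_one θ)))
    nlinarith
  have h1 : (2 * Real.pi) ^ d * (pathLaw d).real {x | pos x n = z} ≤
      2 * Real.sqrt (Real.pi ^ 3 * d / (2 * n)) ^ d := by
    rw [measure_pos_eq_integral]
    calc ∫ θ, Real.cos (∑ j, θ j * z j) * stepChar θ ^ n ∂(cubeMeasure d)
        ≤ ∫ θ, (Real.exp (-n * (1 - 1 * stepChar θ)) + Real.exp (-n * (1 - -1 * stepChar θ)))
            ∂(cubeMeasure d) := by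
          refine integral_mono (integrable_cos_mul_stepChar_pow z n) ((hint 1).add (hint (-1)))
            fun θ => ?_
          have h := abs_pow_le_exp_add_exp (stepChar θ) n
          have h' : Real.cos (∑ j, θ j * z j) * stepChar θ ^ n ≤ |stepChar θ| ^ n := by
            refine (le_abs_self _).trans ?_
            rw [abs_mul, abs_pow]
            exact mul_le_of_le_one_left (by positivity) (Real.abs_cos_le_one _)
          simp only [one_mul, neg_mul, sub_neg_eq_add] at h ⊢
          exact h'.trans h
      _ ≤ 2 * Real.sqrt (Real.pi ^ 3 * d / (2 * n)) ^ d := by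
          rw [integral_add (hint 1) (hint (-1)), two_mul]
          exact add_le_add (integral_exp_stepChar_le hn (Or.inl rfl))
            (integral_exp_stepChar_le hn (Or.inr rfl))
  -- The natural order is `n^(-d/2)`; it is weakened to `n^(-3/2)` by `d ≥ 3` and `n ≥ 1`.
  have h2 : Real.sqrt (Real.pi ^ 3 * d / (2 * n)) ^ d ≤ K ^ d * (n : ℝ) ^ (-(3 / 2) : ℝ) := by
    rw [show Real.pi ^ 3 * d / (2 * n) = Real.pi ^ 3 * d / 2 / n by field_simp,
      Real.sqrt_div' _ hn'.le, ← hK, div_pow, div_eq_mul_inv]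
    refine mul_le_mul_of_nonneg_left ?_ (by positivity)
    rw [Real.rpow_neg hn'.le]
    refine inv_anti₀ (by positivity) ?_
    rw [Real.sqrt_eq_rpow, ← Real.rpow_natCast, ← Real.rpow_mul hn'.le]
    refine Real.rpow_le_rpow_of_exponent_le (by exact_mod_cast hn) ?_
    have : (3 : ℝ) ≤ d := by exact_mod_cast hd
    linarith
  rw [div_mul_eq_mul_div, le_div_iff₀ hpi]
  linarith

end HeatKernel

/-! ### Union bound and Borel–Cantelli with real-valued bounds -/

lemma measureReal_iUnion_le_tsum {α ι : Type*} [Countable ι] [MeasurableSpace α] {μ : Measure α}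
    [IsFiniteMeasure μ] {A : ι → Set α} {b : ι → ℝ} (hA : ∀ n, μ.real (A n) ≤ b n)
    (hb : Summable b) : μ.real (⋃ n, A n) ≤ ∑' n, b n := by
  have h0 : ∀ n, 0 ≤ b n := fun n => measureReal_nonneg.trans (hA n)
  refine ENNReal.toReal_le_of_le_ofReal (tsum_nonneg h0) ?_
  rw [ENNReal.ofReal_tsum_of_nonneg h0 hb]
  exact (measure_iUnion_le A).trans (ENNReal.tsum_le_tsum fun n =>
    (ENNReal.le_ofReal_iff_toReal_le (measure_ne_top _ _) (h0 n)).2 (hA n))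

lemma ae_eventually_notMem_of_summable {α : Type*} [MeasurableSpace α] {μ : Measure α}
    [IsFiniteMeasure μ] {A : ℕ → Set α} {b : ℕ → ℝ} (hA : ∀ n, μ.real (A n) ≤ b n)
    (hb : Summable b) : ∀ᵐ x ∂μ, ∀ᶠ n in Filter.atTop, x ∉ A n := by
  have h0 : ∀ n, 0 ≤ b n := fun n => measureReal_nonneg.trans (hA n)
  refine ae_eventually_notMem (ne_of_lt ?_)
  calc ∑' n, μ (A n) ≤ ∑' n, ENNReal.ofReal (b n) := ENNReal.tsum_le_tsum fun n =>
        (ENNReal.le_ofReal_iff_toReal_le (measure_ne_top _ _) (h0 n)).2 (hA n)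
    _ = ENNReal.ofReal (∑' n, b n) := (ENNReal.ofReal_tsum_of_nonneg h0 hb).symm
    _ < ∞ := ENNReal.ofReal_lt_top

/-! ### Late visits and transience -/

section Transience

variable {d : ℕ}

/-- The paths that visit `z` at a positive time. -/
def hitting (z : Fin d → ℤ) : Set (ℕ → Fin d ⊕ Fin d) := {x | ∃ k, 0 < k ∧ pos x k = z}

lemma measurableSet_hitting (z : Fin d → ℤ) : MeasurableSet (hitting z) := by
  have : hitting z = ⋃ k : ℕ, ⋃ _ : 0 < k, {x | pos x k = z} := by ext; simp [hitting]
  rw [this]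
  exact .iUnion fun k => .iUnion fun _ => measurableSet_pos_eq k z

variable [NeZero d]

/-- The probability of a visit to a given site after time `s` decays polynomially in `s`. -/
lemma exists_measure_late_visit_le (hd : 3 ≤ d) :
    ∃ C : ℝ, 0 < C ∧ ∀ (s : ℕ) (z : Fin d → ℤ), 0 < s →
      (pathLaw d).real {x | ∃ m, s < m ∧ pos x m = z} ≤ C * (s : ℝ) ^ (-(1 / 4) : ℝ) := by
  obtain ⟨K, hK, hbound⟩ := exists_measure_pos_le hd
  have hsum : Summable fun m : ℕ => (m : ℝ) ^ (-(5 / 4) : ℝ) := by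
    rw [Real.summable_nat_rpow]; norm_num
  set T := ∑' m : ℕ, (m : ℝ) ^ (-(5 / 4) : ℝ)
  have hT : 0 ≤ T := tsum_nonneg fun m => by positivity
  refine ⟨K * (T + 1), by positivity, fun s z hs => ?_⟩
  have hs' : (0 : ℝ) < s := Nat.cast_pos.2 hs
  let b : ℕ → ℝ := fun m => K * (s : ℝ) ^ (-(1 / 4) : ℝ) * (m : ℝ) ^ (-(5 / 4) : ℝ)
  have hset : {x : ℕ → Fin d ⊕ Fin d | ∃ m, s < m ∧ pos x m = z} =
      ⋃ m, {x | s < m ∧ pos x m = z} := by ext; simp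
  have hle : (pathLaw d).real {x | ∃ m, s < m ∧ pos x m = z} ≤ ∑' m, b m := by
    rw [hset]
    refine measureReal_iUnion_le_tsum (fun m => ?_) (hsum.mul_left _)
    by_cases hm : s < m
    · simp only [hm, true_and]
      have hm' : (0 : ℝ) < m := Nat.cast_pos.2 (hs.trans hm)
      refine (hbound m z (hs.trans hm)).trans ?_
      simp only [b]
      rw [mul_assoc]
      refine mul_le_mul_of_nonneg_left ?_ hK.le
      -- The exponent is split: `m^(-1/4)` is bounded by `s^(-1/4)` because `m > s`, and `m^(-5/4)`
      -- stays summable.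
      rw [show (-(3 / 2) : ℝ) = -(1 / 4) + -(5 / 4) by norm_num, Real.rpow_add hm']
      refine mul_le_mul_of_nonneg_right ?_ (by positivity)
      exact Real.rpow_le_rpow_of_nonpos hs' (by exact_mod_cast hm.le) (by norm_num)
    · simp only [hm, false_and, Set.ofPred_false, measureReal_empty]
      positivity
  refine hle.trans ?_
  simp only [b]
  rw [tsum_mul_left]
  have : 0 ≤ K * (s : ℝ) ^ (-(1 / 4) : ℝ) := by positivity
  nlinarith

lemma ae_eventually_pos_ne (hd : 3 ≤ d) (z : Fin d → ℤ) :
    ∀ᵐ x ∂(pathLaw d), ∀ᶠ m in Filter.atTop, pos x m ≠ z := by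
  obtain ⟨K, hK, hbound⟩ := exists_measure_pos_le hd
  have hsum : Summable fun m : ℕ => (m : ℝ) ^ (-(3 / 2) : ℝ) := by
    rw [Real.summable_nat_rpow]; norm_num
  have hsum' : Summable fun m : ℕ => K * ((m + 1 : ℕ) : ℝ) ^ (-(3 / 2) : ℝ) :=
    ((summable_nat_add_iff 1).2 hsum).mul_left K
  have h := ae_eventually_notMem_of_summable
    (fun m => hbound (m + 1) z (Nat.succ_pos m)) hsum'
  filter_upwards [h] with x hx
  rw [Filter.eventually_atTop] at hx ⊢
  obtain ⟨N, hN⟩ := hx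
  refine ⟨N + 1, fun m hm => ?_⟩
  have := hN (m - 1) (by omega)
  rwa [Nat.sub_add_cancel (by omega)] at this

/-- The probability that the canonical walk never returns to the origin. -/
noncomputable def escape (d : ℕ) [NeZero d] : ℝ :=
  (pathLaw d).real {x | ∀ k, 0 < k → pos x k ≠ 0}

lemma measure_hitting_zero : (pathLaw d).real (hitting 0) = 1 - escape d := by
  have h : hitting (0 : Fin d → ℤ) = {x | ∀ k, 0 < k → pos x k ≠ 0}ᶜ := by
    ext x; simp [hitting]
  have h' : MeasurableSet {x : ℕ → Fin d ⊕ Fin d | ∀ k, 0 < k → pos x k ≠ 0} := by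
    have := (measurableSet_hitting (0 : Fin d → ℤ)).compl
    rwa [h, compl_compl] at this
  rw [h, probReal_compl_eq_one_sub h', escape]

/-- Pólya's theorem: the walk is transient in dimension at least three. -/
theorem escape_pos (hd : 3 ≤ d) : 0 < escape d := by
  refine lt_of_le_of_ne measureReal_nonneg fun h0 => ?_
  have hmeas : MeasurableSet {x : ℕ → Fin d ⊕ Fin d | ∀ k, 0 < k → pos x k ≠ 0} := by
    have := (measurableSet_hitting (0 : Fin d → ℤ)).compl
    convert this using 1
    ext x; simp [hitting]
  -- If `γ = 0`, almost surely no time `k` is the last visit to the origin. But there are only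
  -- finitely many visits and time `0` is one of them, so a last one exists.
  have hlast : ∀ k, ∀ᵐ x ∂(pathLaw d),
      ¬(pos x k = 0 ∧ ∀ m, 0 < m → pos (shift k x) m ≠ 0) := fun k => by
    have hdet : DeterminedBy k {x : ℕ → Fin d ⊕ Fin d | pos x k = 0} := fun x y hxy hx => by
      rw [Set.mem_ofPred_eq, ← pos_congr hxy le_rfl]; exact hx
    have h := measure_inter_shift_preimage hdet hmeas
    rw [← escape, ← h0, mul_zero, measureReal_eq_zero_iff] at h
    rw [ae_iff]
    convert h using 2
    ext x; simp
  obtain ⟨x, hfin, hx⟩ := ((ae_eventually_pos_ne hd 0).and (ae_all_iff.2 hlast)).exists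
  obtain ⟨N, hN⟩ := Filter.eventually_atTop.1 hfin
  classical
  have h1 := Nat.findGreatest_spec (P := fun k => pos x k = 0) (Nat.zero_le N) (pos_zero x)
  refine hx _ ⟨h1, fun m hm hm0 => ?_⟩
  have h2 : pos x (Nat.findGreatest (fun k => pos x k = 0) N + m) = 0 := by
    rw [pos_add, h1, hm0, add_zero]
  rcases le_or_gt (Nat.findGreatest (fun k => pos x k = 0) N + m) N with hle | hlt
  · exact absurd (Nat.le_findGreatest (P := fun k => pos x k = 0) hle h2) (by omega)
  · exact hN _ hlt.le h2

end Transience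

/-! ### Lattice symmetries and the probability of hitting a neighbour -/

section Symmetry

variable {d : ℕ}

lemma pos_perm {τ : Equiv.Perm (Fin d ⊕ Fin d)} {σ : (Fin d → ℤ) →+ (Fin d → ℤ)}
    (h : ∀ a, σ (unitStep d a) = unitStep d (τ a)) (x : ℕ → Fin d ⊕ Fin d) (n : ℕ) :
    pos (fun k => τ (x k)) n = σ (pos x n) := by
  simp [pos, map_sum, h]

lemma measure_hitting_map [NeZero d] {τ : Equiv.Perm (Fin d ⊕ Fin d)}
    {σ : (Fin d → ℤ) →+ (Fin d → ℤ)} (h : ∀ a, σ (unitStep d a) = unitStep d (τ a))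
    (hσ : Function.Injective σ) (z : Fin d → ℤ) :
    (pathLaw d).real (hitting (σ z)) = (pathLaw d).real (hitting z) := by
  rw [← measure_perm_preimage τ (measurableSet_hitting (σ z))]
  congr 1
  ext x
  simp [hitting, pos_perm h, hσ.eq_iff]

@[simp] lemma unitStep_swap (i : Fin d ⊕ Fin d) : unitStep d i.swap = -unitStep d i := by
  rcases i with j | j <;> simp [unitStep]

lemma unitStep_ne_zero (i : Fin d ⊕ Fin d) : unitStep d i ≠ 0 := by
  rcases i with j | j <;> simp [unitStep]

lemma measure_hitting_unitStep_swap [NeZero d] (i : Fin d ⊕ Fin d) :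
    (pathLaw d).real (hitting (unitStep d i.swap)) =
      (pathLaw d).real (hitting (unitStep d i)) := by
  have h := measure_hitting_map (τ := Equiv.sumComm (Fin d) (Fin d))
    (σ := negAddMonoidHom) (fun a => by simp) neg_injective (unitStep d i)
  simpa using h

/-- Coordinate transpositions relate the positive directions to each other, and negation relates the
negative ones to them. -/
lemma measure_hitting_unitStep_eq [NeZero d] (i j : Fin d ⊕ Fin d) :
    (pathLaw d).real (hitting (unitStep d i)) = (pathLaw d).real (hitting (unitStep d j)) := by
  have key : ∀ a b : Fin d, (pathLaw d).real (hitting (unitStep d (Sum.inl a))) =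
      (pathLaw d).real (hitting (unitStep d (Sum.inl b))) := fun a b => by
    let e : (Fin d → ℤ) ≃+ (Fin d → ℤ) :=
      { Equiv.arrowCongr (Equiv.swap a b) (Equiv.refl ℤ) with map_add' := fun _ _ => rfl }
    have hsingle : ∀ c : Fin d, e (Pi.single c 1) = Pi.single (Equiv.swap a b c) 1 := fun c => by
      ext k
      change (Pi.single c (1 : ℤ) : Fin d → ℤ) ((Equiv.swap a b).symm k) = _
      simp only [Pi.single_apply, Equiv.symm_apply_eq]
    have h := measure_hitting_map (σ := e.toAddMonoidHom)
      (τ := Equiv.sumCongr (Equiv.swap a b) (Equiv.swap a b)) (fun c => by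
        rcases c with c | c
        · exact hsingle c
        · change e (-Pi.single c 1) = -Pi.single (Equiv.swap a b c) 1
          rw [map_neg, hsingle]) e.injective (unitStep d (Sum.inl a))
    rw [← h]
    congr 2
    change e (Pi.single a 1) = _
    rw [hsingle, Equiv.swap_apply_left]
    rfl
  have hinl : ∀ i : Fin d ⊕ Fin d, ∃ a, (pathLaw d).real (hitting (unitStep d i)) =
      (pathLaw d).real (hitting (unitStep d (Sum.inl a))) := by
    rintro (a | a)
    · exact ⟨a, rfl⟩
    · exact ⟨a, (measure_hitting_unitStep_swap (Sum.inl a))⟩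
  obtain ⟨a, ha⟩ := hinl i
  obtain ⟨b, hb⟩ := hinl j
  rw [ha, hb, key a b]

/-- After the first step, returning to the origin means hitting the opposite neighbour. All
neighbours being equally likely to be hit, the average over the first step is their common value. -/
lemma measure_hitting_unitStep [NeZero d] (i : Fin d ⊕ Fin d) :
    (pathLaw d).real (hitting (unitStep d i)) = 1 - escape d := by
  have h := measure_eq_sum_first_step (d := d) (B := hitting 0)
    (A := fun j => hitting (unitStep d j.swap)) (fun j => measurableSet_hitting _) fun x => ?_
  · rw [← measure_hitting_zero, h,
      Finset.sum_congr rfl fun j _ => measure_hitting_unitStep_eq j.swap i]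
    have : (d : ℝ) ≠ 0 := Nat.cast_ne_zero.2 (NeZero.ne d)
    simp only [Finset.sum_const, Finset.card_univ, Fintype.card_sum, Fintype.card_fin,
      nsmul_eq_mul, Nat.cast_add]
    field_simp
    ring
  · have hp : ∀ k, pos x (1 + k) = unitStep d (x 0) + pos (shift 1 x) k := fun k => by
      rw [pos_add]; simp [pos]
    simp only [hitting, unitStep_swap, Set.mem_ofPred_eq]
    constructor
    · rintro ⟨k, hk, h0⟩
      obtain ⟨k, rfl⟩ := Nat.exists_eq_add_of_le hk
      rw [Nat.succ_eq_add_one, zero_add, hp] at h0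
      refine ⟨k, Nat.pos_of_ne_zero ?_, (neg_eq_of_add_eq_zero_right h0).symm⟩
      rintro rfl
      exact unitStep_ne_zero (x 0) (by simpa using h0)
    · rintro ⟨k, hk, h0⟩
      exact ⟨1 + k, by omega, by rw [hp, h0, add_neg_cancel]⟩

lemma escape_lt_one [NeZero d] : escape d < 1 := by
  have i : Fin d ⊕ Fin d := Sum.inl ⟨0, NeZero.pos d⟩
  have h1 : (pathLaw d).real {x | x 0 = i} ≤ (pathLaw d).real (hitting (unitStep d i)) := by
    refine measureReal_mono fun x hx => ⟨1, one_pos, ?_⟩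
    have hx' : x 0 = i := hx
    simp [pos, hx']
  rw [measure_first_step, measure_hitting_unitStep] at h1
  have : (0 : ℝ) < 1 / (2 * d) := by
    have : (0 : ℝ) < d := Nat.cast_pos.2 (NeZero.pos d)
    positivity
  linarith

end Symmetry

/-! ### The first visit to a pair of adjacent sites -/

section FirstVisit

variable {d : ℕ}

/-- The paths whose first visit to `{0, e}` after time `0` happens at time `m`, at the site `v`. -/
def firstVisit (e v : Fin d → ℤ) (m : ℕ) : Set (ℕ → Fin d ⊕ Fin d) :=
  {x | 0 < m ∧ pos x m = v ∧ ∀ j, 0 < j → j < m → pos x j ≠ 0 ∧ pos x j ≠ e}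

/-- The paths whose first visit to `{0, e}` happens at a time in `M`, at the site `v`, and whose
continuation from then on lies in `A`. -/
def firstVisitThen (e v : Fin d → ℤ) (M : Set ℕ) (A : Set (ℕ → Fin d ⊕ Fin d)) :
    Set (ℕ → Fin d ⊕ Fin d) :=
  {x | ∃ m ∈ M, x ∈ firstVisit e v m ∧ shift m x ∈ A}

lemma determinedBy_firstVisit (e v : Fin d → ℤ) (m : ℕ) : DeterminedBy m (firstVisit e v m) := by
  rintro x y hxy ⟨hm, hv, hj⟩
  refine ⟨hm, by rw [← pos_congr hxy le_rfl, hv], fun j hj0 hjm => ?_⟩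
  rw [← pos_congr hxy hjm.le]
  exact hj j hj0 hjm

lemma firstVisit_unique {e v w : Fin d → ℤ} {m n : ℕ} {x : ℕ → Fin d ⊕ Fin d}
    (hv : v = 0 ∨ v = e) (hw : w = 0 ∨ w = e)
    (hm : x ∈ firstVisit e v m) (hn : x ∈ firstVisit e w n) : m = n := by
  rcases lt_trichotomy m n with h | h | h
  · have := hn.2.2 m hm.1 h
    rw [hm.2.1] at this
    tauto
  · exact h
  · have := hm.2.2 n hn.1 h
    rw [hn.2.1] at this
    tauto

lemma exists_firstVisit {e : Fin d → ℤ} {x : ℕ → Fin d ⊕ Fin d} {k : ℕ} (hk : 0 < k)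
    (h : pos x k = 0 ∨ pos x k = e) :
    ∃ m ≤ k, x ∈ firstVisit e 0 m ∨ x ∈ firstVisit e e m := by
  classical
  have hex : ∃ m, 0 < m ∧ (pos x m = 0 ∨ pos x m = e) := ⟨k, hk, h⟩
  obtain ⟨h1, h2⟩ := Nat.find_spec hex
  have h3 : ∀ j, 0 < j → j < Nat.find hex → pos x j ≠ 0 ∧ pos x j ≠ e := fun j hj hjm => by
    have := Nat.find_min hex hjm
    tauto
  exact ⟨Nat.find hex, Nat.find_min' hex ⟨hk, h⟩,
    h2.imp (fun h => ⟨h1, h, h3⟩) fun h => ⟨h1, h, h3⟩⟩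

lemma measurableSet_firstVisitThen (e v : Fin d → ℤ) (M : Set ℕ) {A : Set (ℕ → Fin d ⊕ Fin d)}
    (hA : MeasurableSet A) : MeasurableSet (firstVisitThen e v M A) := by
  have : firstVisitThen e v M A = ⋃ m : ℕ, ⋃ _ : m ∈ M, (firstVisit e v m ∩ shift m ⁻¹' A) := by
    ext; simp [firstVisitThen, and_left_comm]
  rw [this]
  exact .iUnion fun m => .iUnion fun _ =>
    (determinedBy_firstVisit e v m).measurableSet.inter (measurable_shift m hA)

lemma disjoint_firstVisitThen {e : Fin d → ℤ} (he : e ≠ 0) (M N : Set ℕ)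
    (A B : Set (ℕ → Fin d ⊕ Fin d)) :
    Disjoint (firstVisitThen e 0 M A) (firstVisitThen e e N B) := by
  rw [Set.disjoint_left]
  rintro x ⟨m, _, hm, _⟩ ⟨n, _, hn, _⟩
  obtain rfl := firstVisit_unique (Or.inl rfl) (Or.inr rfl) hm hn
  exact he (hn.2.1.symm.trans hm.2.1)

/-- Decomposition at the first visit to `{0, e}`; once the walk is at `e`, the origin lies at `-e`
relative to it. -/
lemma hitting_zero_eq (e : Fin d → ℤ) (he : e ≠ 0) :
    hitting 0 = firstVisitThen e 0 Set.univ Set.univ ∪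
      firstVisitThen e e Set.univ (hitting (-e)) := by
  ext x
  constructor
  · rintro ⟨k, hk, h0⟩
    obtain ⟨m, hmk, hm | hm⟩ := exists_firstVisit (e := e) hk (Or.inl h0)
    · exact Or.inl ⟨m, trivial, hm, trivial⟩
    · refine Or.inr ⟨m, trivial, hm, k - m, ?_, ?_⟩
      · refine Nat.sub_pos_of_lt (lt_of_le_of_ne hmk ?_)
        rintro rfl
        exact he (hm.2.1.symm.trans h0)
      · have := pos_add x m (k - m)
        rw [Nat.add_sub_cancel' hmk, h0, hm.2.1] at this
        exact (neg_eq_of_add_eq_zero_right this.symm).symm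
  · rintro (⟨m, _, hm, _⟩ | ⟨m, _, hm, k, hk, hp⟩)
    · exact ⟨m, hm.1, hm.2.1⟩
    · exact ⟨m + k, by omega, by rw [pos_add, hm.2.1, hp, add_neg_cancel]⟩

lemma hitting_eq (e : Fin d → ℤ) (he : e ≠ 0) :
    hitting e = firstVisitThen e 0 Set.univ (hitting e) ∪
      firstVisitThen e e Set.univ Set.univ := by
  ext x
  constructor
  · rintro ⟨k, hk, h0⟩
    obtain ⟨m, hmk, hm | hm⟩ := exists_firstVisit (e := e) hk (Or.inr h0)
    · refine Or.inl ⟨m, trivial, hm, k - m, ?_, ?_⟩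
      · refine Nat.sub_pos_of_lt (lt_of_le_of_ne hmk ?_)
        rintro rfl
        exact he (h0.symm.trans hm.2.1)
      · have := pos_add x m (k - m)
        rw [Nat.add_sub_cancel' hmk, h0, hm.2.1, zero_add] at this
        exact this.symm
    · exact Or.inr ⟨m, trivial, hm, trivial⟩
  · rintro (⟨m, _, hm, k, hk, hp⟩ | ⟨m, _, hm, _⟩)
    · exact ⟨m + k, by omega, by rw [pos_add, hm.2.1, hp, zero_add]⟩
    · exact ⟨m, hm.1, hm.2.1⟩

variable [NeZero d]

/-- The Markov property at the first visit to `{0, e}`. -/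
lemma measure_firstVisitThen {e v : Fin d → ℤ} (hv : v = 0 ∨ v = e) (M : Set ℕ)
    {A : Set (ℕ → Fin d ⊕ Fin d)} (hA : MeasurableSet A) :
    (pathLaw d).real (firstVisitThen e v M A) =
      (pathLaw d).real (firstVisitThen e v M Set.univ) * (pathLaw d).real A := by
  have key : ∀ B : Set (ℕ → Fin d ⊕ Fin d), MeasurableSet B →
      pathLaw d (firstVisitThen e v M B) =
        (∑' m : M, pathLaw d (firstVisit e v m)) * pathLaw d B := fun B hB => by
    have hset : firstVisitThen e v M B = ⋃ m : M, (firstVisit e v m ∩ shift m ⁻¹' B) := by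
      ext; simp [firstVisitThen, and_left_comm]
    rw [hset, measure_iUnion, ← ENNReal.tsum_mul_right]
    · refine tsum_congr fun m => ?_
      have h := measure_inter_shift_preimage (determinedBy_firstVisit e v m) hB
      rwa [measureReal_def, measureReal_def, measureReal_def, ← ENNReal.toReal_mul,
        ENNReal.toReal_eq_toReal_iff' (measure_ne_top _ _)
          (ENNReal.mul_ne_top (measure_ne_top _ _) (measure_ne_top _ _))] at h
    · intro m n hmn
      rw [Function.onFun, Set.disjoint_left]
      exact fun x hx hx' => hmn (Subtype.ext (firstVisit_unique hv hv hx.1 hx'.1))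
    · exact fun m => (determinedBy_firstVisit e v m).measurableSet.inter (measurable_shift _ hB)
  rw [measureReal_def, measureReal_def, measureReal_def, key A hA, key _ .univ, measure_univ,
    mul_one, ENNReal.toReal_mul]

/-- The probability that the next visit to a pair of adjacent sites is at a given one of them. -/
noncomputable def nextProb (d : ℕ) [NeZero d] : ℝ := (1 - escape d) / (2 - escape d)

lemma nextProb_pos : 0 < nextProb d := by
  have := escape_lt_one (d := d)
  exact div_pos (by linarith) (by linarith)

/-- Transience in disguise: `1 - 2α = γ / (2 - γ)`. -/
lemma two_mul_nextProb_lt_one (hd : 3 ≤ d) : 2 * nextProb d < 1 := by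
  have := escape_lt_one (d := d)
  have := escape_pos hd
  rw [nextProb, mul_div_assoc', div_lt_one (by linarith)]
  linarith

lemma measure_firstVisitThen_univ (hd : 3 ≤ d) (i : Fin d ⊕ Fin d) {v : Fin d → ℤ}
    (hv : v = 0 ∨ v = unitStep d i) :
    (pathLaw d).real (firstVisitThen (unitStep d i) v Set.univ Set.univ) = nextProb d := by
  set e := unitStep d i with he
  have he0 : e ≠ 0 := unitStep_ne_zero i
  have h1 : (pathLaw d).real (hitting e) = 1 - escape d := measure_hitting_unitStep i
  have h2 : (pathLaw d).real (hitting (-e)) = 1 - escape d := by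
    rw [he, ← unitStep_swap]; exact measure_hitting_unitStep i.swap
  have h3 := measure_hitting_zero (d := d)
  have hγ := escape_pos hd
  have hγ1 := escape_lt_one (d := d)
  have h4 := h1
  rw [hitting_zero_eq e he0, measureReal_union (disjoint_firstVisitThen he0 _ _ _ _)
    (measurableSet_firstVisitThen _ _ _ (measurableSet_hitting _)),
    measure_firstVisitThen (Or.inr rfl) _ (measurableSet_hitting _), h2] at h3
  rw [hitting_eq e he0, measureReal_union (disjoint_firstVisitThen he0 _ _ _ _)
    (measurableSet_firstVisitThen _ _ _ .univ),
    measure_firstVisitThen (Or.inl rfl) _ (measurableSet_hitting _), h1] at h4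
  set a := (pathLaw d).real (firstVisitThen e 0 Set.univ Set.univ)
  set b := (pathLaw d).real (firstVisitThen e e Set.univ Set.univ)
  -- The two decompositions read `a + b(1-γ) = 1-γ` and `a(1-γ) + b = 1-γ`. Their difference is
  -- `(a-b)γ = 0`, and `γ > 0`.
  have hab : a = b := by
    have : (a - b) * escape d = 0 := by linarith
    rcases mul_eq_zero.1 this with h | h <;> linarith
  have hb : a = nextProb d := by
    rw [nextProb, eq_div_iff (by linarith)]
    rw [← hab] at h3
    linarith
  rcases hv with rfl | rfl
  · exact hb
  · exact hab.symm.trans hb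

lemma measure_firstVisitThen_late_le (e v : Fin d → ℤ) (s : ℕ) :
    (pathLaw d).real (firstVisitThen e v (Set.Ioi s) Set.univ) ≤
      (pathLaw d).real {x | ∃ m, s < m ∧ pos x m = v} :=
  measureReal_mono fun _ ⟨m, hm, h, _⟩ => ⟨m, hm, h.2.1⟩

end FirstVisit

/-! ### Counting visits to two adjacent sites; recursion at the first visit -/

section Visits

variable {d : ℕ}

/-- The number of visits to `z` during the times `1, …, R`. -/
def visits (x : ℕ → Fin d ⊕ Fin d) (z : Fin d → ℤ) (R : ℕ) : ℕ :=
  ((Finset.Ioc 0 R).filter fun m => pos x m = z).card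

@[simp] lemma visits_zero (x : ℕ → Fin d ⊕ Fin d) (z : Fin d → ℤ) : visits x z 0 = 0 := by
  simp [visits]

lemma visits_succ (x : ℕ → Fin d ⊕ Fin d) (z : Fin d → ℤ) (R : ℕ) :
    visits x z (R + 1) = visits x z R + if pos x (R + 1) = z then 1 else 0 := by
  have h : Finset.Ioc 0 (R + 1) = insert (R + 1) (Finset.Ioc 0 R) := by
    ext; simp; omega
  rw [visits, h, Finset.filter_insert]
  split_ifs with hp
  · rw [Finset.card_insert_of_notMem (by simp), visits]
  · rfl

lemma visits_add (x : ℕ → Fin d ⊕ Fin d) (z : Fin d → ℤ) (m r : ℕ) :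
    visits x z (m + r) = visits x z m + visits (shift m x) (z - pos x m) r := by
  induction r with
  | zero => simp
  | succ r ih =>
    rw [← add_assoc, visits_succ, visits_succ, ih, add_assoc, add_assoc m r 1, pos_add]
    simp only [eq_sub_iff_add_eq, add_comm]

lemma visits_mono (x : ℕ → Fin d ⊕ Fin d) (z : Fin d → ℤ) : Monotone (visits x z) :=
  monotone_nat_of_le_succ fun R => by rw [visits_succ]; exact Nat.le_add_right _ _

lemma visits_congr {x y : ℕ → Fin d ⊕ Fin d} {N R : ℕ} (h : ∀ k < N, x k = y k) (hR : R ≤ N)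
    (z : Fin d → ℤ) : visits x z R = visits y z R := by
  unfold visits
  congr 1
  refine Finset.filter_congr fun m hm => ?_
  rw [pos_congr h ((Finset.mem_Ioc.1 hm).2.trans hR)]

lemma determinedBy_visits (z w : Fin d → ℤ) (R k l : ℕ) :
    DeterminedBy R {x : ℕ → Fin d ⊕ Fin d | visits x z R = k ∧ visits x w R = l} :=
  fun x y hxy hx => by
    rw [Set.mem_ofPred_eq, ← visits_congr hxy le_rfl, ← visits_congr hxy le_rfl]; exact hx

lemma visits_eq_zero_of_firstVisit {e v z : Fin d → ℤ} {m r : ℕ} {x : ℕ → Fin d ⊕ Fin d}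
    (hx : x ∈ firstVisit e v m) (hr : r < m) (hz : z = 0 ∨ z = e) : visits x z r = 0 := by
  rw [visits, Finset.card_eq_zero, Finset.filter_eq_empty_iff]
  intro j hj hjz
  rw [Finset.mem_Ioc] at hj
  have := hx.2.2 j hj.1 (by omega)
  rcases hz with rfl | rfl <;> tauto

lemma visits_firstVisit {e v z : Fin d → ℤ} {m : ℕ} {x : ℕ → Fin d ⊕ Fin d}
    (hx : x ∈ firstVisit e v m) (hz : z = 0 ∨ z = e) :
    visits x z m = if v = z then 1 else 0 := by
  obtain ⟨m, rfl⟩ := Nat.exists_eq_succ_of_ne_zero hx.1.ne'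
  rw [Nat.succ_eq_add_one, visits_succ, visits_eq_zero_of_firstVisit hx (Nat.lt_succ_self m) hz,
    zero_add, ← hx.2.1]

lemma visits_add_of_firstVisit_zero {e : Fin d → ℤ} (he : e ≠ 0) {m : ℕ}
    {x : ℕ → Fin d ⊕ Fin d} (hx : x ∈ firstVisit e 0 m) (r : ℕ) :
    visits x 0 (m + r) = visits (shift m x) 0 r + 1 ∧
      visits x e (m + r) = visits (shift m x) e r := by
  rw [visits_add, visits_add, visits_firstVisit hx (Or.inl rfl), visits_firstVisit hx (Or.inr rfl),
    hx.2.1]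
  simp [he.symm, add_comm]

lemma visits_add_of_firstVisit_self {e : Fin d → ℤ} (he : e ≠ 0) {m : ℕ}
    {x : ℕ → Fin d ⊕ Fin d} (hx : x ∈ firstVisit e e m) (r : ℕ) :
    visits x 0 (m + r) = visits (shift m x) (-e) r ∧
      visits x e (m + r) = visits (shift m x) 0 r + 1 := by
  rw [visits_add, visits_add, visits_firstVisit hx (Or.inl rfl), visits_firstVisit hx (Or.inr rfl),
    hx.2.1]
  simp [he, add_comm]

/-- At some time the numbers of visits to `0` and `e` are `k` and `l`. -/
def reached (e : Fin d → ℤ) (k l : ℕ) : Set (ℕ → Fin d ⊕ Fin d) :=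
  {x | ∃ R, visits x 0 R = k ∧ visits x e R = l}

/-- The total numbers of visits to `0` and `e` are `k` and `l`. -/
def total (e : Fin d → ℤ) (k l : ℕ) : Set (ℕ → Fin d ⊕ Fin d) :=
  {x | ∃ N, ∀ R, N ≤ R → visits x 0 R = k ∧ visits x e R = l}

/-- At some visit to `{0, e}` after time `s`, the numbers of visits to `0` and `e` are
`k` and `l`. -/
def late (s : ℕ) (e : Fin d → ℤ) (k l : ℕ) : Set (ℕ → Fin d ⊕ Fin d) :=
  {x | ∃ R, s < R ∧ (pos x R = 0 ∨ pos x R = e) ∧ visits x 0 R = k ∧ visits x e R = l}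

lemma measurableSet_reached (e : Fin d → ℤ) (k l : ℕ) : MeasurableSet (reached e k l) := by
  have : reached e k l = ⋃ R, {x | visits x 0 R = k ∧ visits x e R = l} := by
    ext; simp [reached]
  rw [this]
  exact .iUnion fun R => (determinedBy_visits 0 e R k l).measurableSet

lemma measurableSet_total (e : Fin d → ℤ) (k l : ℕ) : MeasurableSet (total e k l) := by
  have : total e k l =
      ⋃ N, ⋂ R, ⋂ _ : N ≤ R, {x | visits x 0 R = k ∧ visits x e R = l} := by
    ext; simp [total]
  rw [this]
  exact .iUnion fun N => .iInter fun R => .iInter fun _ =>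
    (determinedBy_visits 0 e R k l).measurableSet

lemma measurableSet_late (s : ℕ) (e : Fin d → ℤ) (k l : ℕ) : MeasurableSet (late s e k l) := by
  have : late s e k l = ⋃ R, ⋃ _ : s < R, (({x | pos x R = 0} ∪ {x | pos x R = e}) ∩
      {x | visits x 0 R = k ∧ visits x e R = l}) := by
    ext; simp [late, and_left_comm]
  rw [this]
  exact .iUnion fun R => .iUnion fun _ => ((measurableSet_pos_eq R 0).union
    (measurableSet_pos_eq R e)).inter (determinedBy_visits 0 e R k l).measurableSet

lemma late_anti {s t : ℕ} (h : s ≤ t) (e : Fin d → ℤ) (k l : ℕ) : late t e k l ⊆ late s e k l :=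
  fun _ ⟨R, hR, hx⟩ => ⟨R, h.trans_lt hR, hx⟩

/-- The event that remains to happen after a visit to `0`, for a family `F` indexed by the numbers
of visits to `0` and `e`. -/
def afterZero (F : (Fin d → ℤ) → ℕ → ℕ → Set (ℕ → Fin d ⊕ Fin d)) (e : Fin d → ℤ) :
    ℕ → ℕ → Set (ℕ → Fin d ⊕ Fin d)
  | 0, _ => ∅
  | k + 1, l => F e k l

/-- The event that remains to happen after a visit to `e`, seen from `e`. -/
def afterSelf (F : (Fin d → ℤ) → ℕ → ℕ → Set (ℕ → Fin d ⊕ Fin d)) (e : Fin d → ℤ) :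
    ℕ → ℕ → Set (ℕ → Fin d ⊕ Fin d)
  | _, 0 => ∅
  -- Seen from `e` the old origin is `-e`, so the two counts exchange their roles.
  | k, l + 1 => F (-e) l k

lemma mem_afterZero {F : (Fin d → ℤ) → ℕ → ℕ → Set (ℕ → Fin d ⊕ Fin d)} {e : Fin d → ℤ} {k l : ℕ}
    {x : ℕ → Fin d ⊕ Fin d} : x ∈ afterZero F e k l ↔ ∃ k', k = k' + 1 ∧ x ∈ F e k' l := by
  cases k <;> simp [afterZero]

lemma mem_afterSelf {F : (Fin d → ℤ) → ℕ → ℕ → Set (ℕ → Fin d ⊕ Fin d)} {e : Fin d → ℤ} {k l : ℕ}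
    {x : ℕ → Fin d ⊕ Fin d} : x ∈ afterSelf F e k l ↔ ∃ l', l = l' + 1 ∧ x ∈ F (-e) l' k := by
  cases l <;> simp [afterSelf]

lemma measurableSet_afterZero {F : (Fin d → ℤ) → ℕ → ℕ → Set (ℕ → Fin d ⊕ Fin d)}
    (hF : ∀ e k l, MeasurableSet (F e k l)) (e : Fin d → ℤ) (k l : ℕ) :
    MeasurableSet (afterZero F e k l) := by
  cases k
  · exact .empty
  · exact hF _ _ _

lemma measurableSet_afterSelf {F : (Fin d → ℤ) → ℕ → ℕ → Set (ℕ → Fin d ⊕ Fin d)}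
    (hF : ∀ e k l, MeasurableSet (F e k l)) (e : Fin d → ℤ) (k l : ℕ) :
    MeasurableSet (afterSelf F e k l) := by
  cases l
  · exact .empty
  · exact hF _ _ _

lemma exists_pos_mem_of_visits {e : Fin d → ℤ} {x : ℕ → Fin d ⊕ Fin d} {k l R : ℕ}
    (hkl : k + l ≠ 0) (hk : visits x 0 R = k) (hl : visits x e R = l) :
    ∃ j, 0 < j ∧ j ≤ R ∧ (pos x j = 0 ∨ pos x j = e) := by
  have : 0 < visits x 0 R ∨ 0 < visits x e R := by omega
  rcases this with h | h
  · obtain ⟨j, hj⟩ := Finset.card_pos.1 h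
    simp only [Finset.mem_filter, Finset.mem_Ioc] at hj
    exact ⟨j, hj.1.1, hj.1.2, Or.inl hj.2⟩
  · obtain ⟨j, hj⟩ := Finset.card_pos.1 h
    simp only [Finset.mem_filter, Finset.mem_Ioc] at hj
    exact ⟨j, hj.1.1, hj.1.2, Or.inr hj.2⟩

lemma mem_after_of_visits {e : Fin d → ℤ} (he : e ≠ 0) {x : ℕ → Fin d ⊕ Fin d} {m r k l : ℕ}
    (hk : visits x 0 (m + r) = k) (hl : visits x e (m + r) = l) :
    (x ∈ firstVisit e 0 m → ∃ k', k = k' + 1 ∧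
      visits (shift m x) 0 r = k' ∧ visits (shift m x) e r = l) ∧
    (x ∈ firstVisit e e m → ∃ l', l = l' + 1 ∧
      visits (shift m x) 0 r = l' ∧ visits (shift m x) (-e) r = k) := by
  refine ⟨fun hx => ?_, fun hx => ?_⟩
  · obtain ⟨h1, h2⟩ := visits_add_of_firstVisit_zero he hx r
    exact ⟨_, hk.symm.trans h1, rfl, h2.symm.trans hl⟩
  · obtain ⟨h1, h2⟩ := visits_add_of_firstVisit_self he hx r
    exact ⟨_, hl.symm.trans h2, rfl, h1.symm.trans hk⟩

lemma reached_subset {e : Fin d → ℤ} (he : e ≠ 0) {k l : ℕ} (hkl : k + l ≠ 0) :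
    reached e k l ⊆ firstVisitThen e 0 Set.univ (afterZero reached e k l) ∪
      firstVisitThen e e Set.univ (afterSelf reached e k l) := by
  rintro x ⟨R, hk, hl⟩
  obtain ⟨j, hj0, hjR, hj⟩ := exists_pos_mem_of_visits hkl hk hl
  obtain ⟨m, hmj, hm⟩ := exists_firstVisit hj0 hj
  obtain ⟨r, rfl⟩ := Nat.exists_eq_add_of_le (hmj.trans hjR)
  obtain ⟨h1, h2⟩ := mem_after_of_visits he hk hl
  rcases hm with hm | hm
  · obtain ⟨k', rfl, h⟩ := h1 hm
    exact Or.inl ⟨m, trivial, hm, mem_afterZero.2 ⟨k', rfl, r, h⟩⟩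
  · obtain ⟨l', rfl, h⟩ := h2 hm
    exact Or.inr ⟨m, trivial, hm, mem_afterSelf.2 ⟨l', rfl, r, h⟩⟩

/-- If the first visit occurs by time `s`, more than `t` units of time remain to the visit in
question. If it occurs later, that delay alone is kept and the timing of the remainder is forgotten.
-/
lemma late_subset {e : Fin d → ℤ} (he : e ≠ 0) (s t k l : ℕ) :
    late (s + t) e k l ⊆ (firstVisitThen e 0 Set.univ (afterZero (late t) e k l) ∪
      firstVisitThen e e Set.univ (afterSelf (late t) e k l)) ∪
      (firstVisitThen e 0 (Set.Ioi s) (afterZero reached e k l) ∪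
      firstVisitThen e e (Set.Ioi s) (afterSelf reached e k l)) := by
  rintro x ⟨R, hR, hp, hk, hl⟩
  obtain ⟨m, hmj, hm⟩ := exists_firstVisit (by omega) hp
  obtain ⟨r, rfl⟩ := Nat.exists_eq_add_of_le hmj
  obtain ⟨h1, h2⟩ := mem_after_of_visits he hk hl
  rcases le_or_gt m s with hms | hms
  · refine Or.inl ?_
    rcases hm with hm | hm
    · obtain ⟨k', rfl, h⟩ := h1 hm
      rw [pos_add, hm.2.1, zero_add] at hp
      exact Or.inl ⟨m, trivial, hm, mem_afterZero.2 ⟨k', rfl, r, by omega, hp, h⟩⟩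
    · obtain ⟨l', rfl, h⟩ := h2 hm
      rw [pos_add, hm.2.1] at hp
      have hp' : pos (shift m x) r = 0 ∨ pos (shift m x) r = -e := by
        rcases hp with hp | hp
        · exact Or.inr (neg_eq_of_add_eq_zero_right hp).symm
        · exact Or.inl (by simpa using hp)
      exact Or.inr ⟨m, trivial, hm, mem_afterSelf.2 ⟨l', rfl, r, by omega, hp', h⟩⟩
  · refine Or.inr ?_
    rcases hm with hm | hm
    · obtain ⟨k', rfl, h⟩ := h1 hm
      exact Or.inl ⟨m, hms, hm, mem_afterZero.2 ⟨k', rfl, r, h⟩⟩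
    · obtain ⟨l', rfl, h⟩ := h2 hm
      exact Or.inr ⟨m, hms, hm, mem_afterSelf.2 ⟨l', rfl, r, h⟩⟩

lemma subset_total {e : Fin d → ℤ} (he : e ≠ 0) (k l : ℕ) :
    firstVisitThen e 0 Set.univ (afterZero total e k l) ∪
      firstVisitThen e e Set.univ (afterSelf total e k l) ⊆ total e k l := by
  rintro x (⟨m, _, hm, h⟩ | ⟨m, _, hm, h⟩)
  · obtain ⟨k', rfl, N, hN⟩ := mem_afterZero.1 h
    refine ⟨m + N, fun R hR => ?_⟩
    obtain ⟨r, rfl⟩ := Nat.exists_eq_add_of_le (le_of_add_le_left hR)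
    obtain ⟨h1, h2⟩ := visits_add_of_firstVisit_zero he hm r
    obtain ⟨h3, h4⟩ := hN r (by omega)
    exact ⟨by rw [h1, h3], by rw [h2, h4]⟩
  · obtain ⟨l', rfl, N, hN⟩ := mem_afterSelf.1 h
    refine ⟨m + N, fun R hR => ?_⟩
    obtain ⟨r, rfl⟩ := Nat.exists_eq_add_of_le (le_of_add_le_left hR)
    obtain ⟨h1, h2⟩ := visits_add_of_firstVisit_self he hm r
    obtain ⟨h3, h4⟩ := hN r (by omega)
    exact ⟨by rw [h1, h4], by rw [h2, h3]⟩

end Visits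

/-! ### The combinatorial weights -/

section Weights

/-- `C(k+l, k) a^(k+l)`: the probability that a walk on two adjacent sites, going to either one
with probability `a` at each step, starts with `k` visits to the one and `l` to the other. -/
noncomputable def pairWeight (a : ℝ) (k l : ℕ) : ℝ := (k + l).choose k * a ^ (k + l)

lemma pairWeight_pos {a : ℝ} (ha : 0 < a) (k l : ℕ) : 0 < pairWeight a k l := by
  have : 0 < (k + l).choose k := Nat.choose_pos (Nat.le_add_right k l)
  unfold pairWeight
  positivity

lemma pairWeight_comm (a : ℝ) (k l : ℕ) : pairWeight a k l = pairWeight a l k := by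
  rw [pairWeight, pairWeight, add_comm k l, Nat.choose_symm_add]

/-- The weight that remains after a visit to the first site. -/
noncomputable def pairWeightPred (a : ℝ) : ℕ → ℕ → ℝ
  | 0, _ => 0
  | k + 1, l => pairWeight a k l

/-- Pascal's rule, in the form that matches the decomposition at the first visit. -/
lemma pairWeight_eq (a : ℝ) {k l : ℕ} (hkl : k + l ≠ 0) :
    pairWeight a k l = a * (pairWeightPred a k l + pairWeightPred a l k) := by
  rcases k with _ | k <;> rcases l with _ | l
  · simp at hkl
  · simp [pairWeight, pairWeightPred, pow_succ, mul_comm]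
  · simp [pairWeight, pairWeightPred, pow_succ, mul_comm]
  · rw [pairWeightPred, pairWeightPred, pairWeight_comm a l (k + 1)]
    unfold pairWeight
    rw [show k + 1 + (l + 1) = (k + l + 1) + 1 by ring, Nat.choose_succ_succ,
      show k + (l + 1) = k + l + 1 by ring, show k + 1 + l = k + l + 1 by ring]
    push_cast
    ring

lemma pairWeight_succ_left_le {a : ℝ} (ha : 0 < a) (ha1 : a ≤ 1) (k l : ℕ) :
    pairWeight a (k + 1) l ≤ (k + l + 1) * pairWeight a k l := by
  have h := Nat.add_one_mul_choose_eq (k + l) k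
  have h' : (k + l + 1).choose (k + 1) ≤ (k + l + 1) * (k + l).choose k := by
    rw [h]; exact Nat.le_mul_of_pos_right _ (Nat.succ_pos k)
  have h'' : ((k + l + 1).choose (k + 1) : ℝ) ≤ (k + l + 1) * (k + l).choose k := by
    exact_mod_cast h'
  unfold pairWeight
  rw [show k + 1 + l = k + l + 1 by ring, ← mul_assoc]
  have h3 : a ^ (k + l + 1) ≤ a ^ (k + l) := pow_le_pow_of_le_one ha.le ha1 (Nat.le_succ _)
  calc ((k + l + 1).choose (k + 1) : ℝ) * a ^ (k + l + 1)
      ≤ ((k + l + 1) * (k + l).choose k) * a ^ (k + l) := by gcongr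
    _ = _ := by ring

lemma pairWeight_succ_right_le {a : ℝ} (ha : 0 < a) (ha1 : a ≤ 1) (k l : ℕ) :
    pairWeight a k (l + 1) ≤ (k + l + 1) * pairWeight a k l := by
  rw [pairWeight_comm, pairWeight_comm a k l, add_comm (k : ℝ)]
  exact pairWeight_succ_left_le ha ha1 l k

end Weights

/-! ### Probabilities of prescribed numbers of visits -/

section Bounds

variable {d : ℕ} [NeZero d]

lemma measure_afterZero_le {F : (Fin d → ℤ) → ℕ → ℕ → Set (ℕ → Fin d ⊕ Fin d)} {c : ℝ}
    {e : Fin d → ℤ} {k l : ℕ} (h : ∀ k', k = k' + 1 →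
      (pathLaw d).real (F e k' l) ≤ c * pairWeight (nextProb d) k' l) :
    (pathLaw d).real (afterZero F e k l) ≤ c * pairWeightPred (nextProb d) k l := by
  rcases k with _ | k
  · simp [afterZero, pairWeightPred]
  · exact h k rfl

lemma measure_afterSelf_le {F : (Fin d → ℤ) → ℕ → ℕ → Set (ℕ → Fin d ⊕ Fin d)} {c : ℝ}
    {e : Fin d → ℤ} {k l : ℕ} (h : ∀ l', l = l' + 1 →
      (pathLaw d).real (F (-e) l' k) ≤ c * pairWeight (nextProb d) l' k) :
    (pathLaw d).real (afterSelf F e k l) ≤ c * pairWeightPred (nextProb d) l k := by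
  rcases l with _ | l
  · simp [afterSelf, pairWeightPred]
  · exact h l rfl

lemma le_measure_afterZero {F : (Fin d → ℤ) → ℕ → ℕ → Set (ℕ → Fin d ⊕ Fin d)} {c : ℝ}
    {e : Fin d → ℤ} {k l : ℕ} (h : ∀ k', k = k' + 1 →
      c * pairWeight (nextProb d) k' l ≤ (pathLaw d).real (F e k' l)) :
    c * pairWeightPred (nextProb d) k l ≤ (pathLaw d).real (afterZero F e k l) := by
  rcases k with _ | k
  · simp [afterZero, pairWeightPred]
  · exact h k rfl

lemma le_measure_afterSelf {F : (Fin d → ℤ) → ℕ → ℕ → Set (ℕ → Fin d ⊕ Fin d)} {c : ℝ}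
    {e : Fin d → ℤ} {k l : ℕ} (h : ∀ l', l = l' + 1 →
      c * pairWeight (nextProb d) l' k ≤ (pathLaw d).real (F (-e) l' k)) :
    c * pairWeightPred (nextProb d) l k ≤ (pathLaw d).real (afterSelf F e k l) := by
  rcases l with _ | l
  · simp [afterSelf, pairWeightPred]
  · exact h l rfl

lemma measure_firstVisitThen_union (hd : 3 ≤ d) (i : Fin d ⊕ Fin d)
    {A B : Set (ℕ → Fin d ⊕ Fin d)} (hA : MeasurableSet A) (hB : MeasurableSet B) :
    (pathLaw d).real (firstVisitThen (unitStep d i) 0 Set.univ A ∪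
      firstVisitThen (unitStep d i) (unitStep d i) Set.univ B) =
      nextProb d * ((pathLaw d).real A + (pathLaw d).real B) := by
  rw [measureReal_union (disjoint_firstVisitThen (unitStep_ne_zero i) _ _ _ _)
    (measurableSet_firstVisitThen _ _ _ hB), measure_firstVisitThen (Or.inl rfl) _ hA,
    measure_firstVisitThen (Or.inr rfl) _ hB, measure_firstVisitThen_univ hd i (Or.inl rfl),
    measure_firstVisitThen_univ hd i (Or.inr rfl), mul_add]

/-- Induction on `k + l`: event and weight obey the same recursion. The direction must vary, since a
visit to the neighbour reverses it. -/
lemma measure_reached_le (hd : 3 ≤ d) (i : Fin d ⊕ Fin d) (k l : ℕ) :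
    (pathLaw d).real (reached (unitStep d i) k l) ≤ pairWeight (nextProb d) k l := by
  induction hn : k + l generalizing i k l with
  | zero =>
    obtain ⟨rfl, rfl⟩ := Nat.add_eq_zero_iff.1 hn
    simp [pairWeight]
  | succ n ih =>
    refine (measureReal_mono (reached_subset (unitStep_ne_zero i) (by omega))).trans ?_
    rw [measure_firstVisitThen_union hd i (measurableSet_afterZero measurableSet_reached _ _ _)
      (measurableSet_afterSelf measurableSet_reached _ _ _), pairWeight_eq _ (by omega)]
    have h1 := measure_afterZero_le (F := reached) (c := 1) (e := unitStep d i) (k := k) (l := l)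
      fun k' hk => by rw [one_mul]; exact ih i k' l (by omega)
    have h2 := measure_afterSelf_le (F := reached) (c := 1) (e := unitStep d i) (k := k) (l := l)
      fun l' hl => by
        rw [one_mul, ← unitStep_swap]; exact ih i.swap l' k (by omega)
    exact mul_le_mul_of_nonneg_left (by linarith) nextProb_pos.le

lemma le_measure_total (hd : 3 ≤ d) (i : Fin d ⊕ Fin d) (k l : ℕ) :
    (1 - 2 * nextProb d) * pairWeight (nextProb d) k l ≤
      (pathLaw d).real (total (unitStep d i) k l) := by
  induction hn : k + l generalizing i k l with
  | zero =>
    obtain ⟨rfl, rfl⟩ := Nat.add_eq_zero_iff.1 hn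
    have h := measure_firstVisitThen_union hd i .univ .univ
    -- With no further visit at all, both counts stay zero; this has probability `1 - 2α`.
    have hsub : (firstVisitThen (unitStep d i) 0 Set.univ Set.univ ∪
        firstVisitThen (unitStep d i) (unitStep d i) Set.univ Set.univ)ᶜ ⊆
        total (unitStep d i) 0 0 := by
      intro x hx
      refine ⟨0, fun R _ => ?_⟩
      by_contra hne
      obtain ⟨j, hj0, _, hj⟩ := exists_pos_mem_of_visits (e := unitStep d i) (x := x) (R := R)
        (by omega) rfl rfl
      obtain ⟨m, _, hm⟩ := exists_firstVisit hj0 hj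
      exact hx (hm.imp (fun h => ⟨m, trivial, h, trivial⟩) fun h => ⟨m, trivial, h, trivial⟩)
    refine le_trans ?_ (measureReal_mono hsub)
    rw [probReal_compl_eq_one_sub ((measurableSet_firstVisitThen _ _ _ .univ).union
      (measurableSet_firstVisitThen _ _ _ .univ)), h]
    simp [pairWeight]
    linarith
  | succ n ih =>
    refine le_trans ?_ (measureReal_mono (subset_total (unitStep_ne_zero i) k l))
    rw [measure_firstVisitThen_union hd i (measurableSet_afterZero measurableSet_total _ _ _)
      (measurableSet_afterSelf measurableSet_total _ _ _), pairWeight_eq _ (by omega)]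
    have h1 := le_measure_afterZero (F := total) (c := 1 - 2 * nextProb d) (e := unitStep d i)
      (k := k) (l := l) fun k' hk => ih i k' l (by omega)
    have h2 := le_measure_afterSelf (F := total) (c := 1 - 2 * nextProb d) (e := unitStep d i)
      (k := k) (l := l) fun l' hl => by rw [← unitStep_swap]; exact ih i.swap l' k (by omega)
    rw [mul_left_comm, mul_add]
    exact mul_le_mul_of_nonneg_left (add_le_add h1 h2) nextProb_pos.le

/-- If the visit completing the counts `(k, l)` comes after time `(k+l)s`, one of the `k+l` waiting
times exceeds `s`. The factor `k+l` selects it, and for that waiting time a factor `α` of the weight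
is replaced by `u`. -/
lemma measure_late_mul_le (hd : 3 ≤ d) {s : ℕ} {u : ℝ}
    (hu : ∀ z : Fin d → ℤ, (pathLaw d).real {x | ∃ m, s < m ∧ pos x m = z} ≤ u)
    (i : Fin d ⊕ Fin d) (k l : ℕ) :
    (pathLaw d).real (late ((k + l) * s) (unitStep d i) k l) ≤
      (k + l) * u / nextProb d * pairWeight (nextProb d) k l := by
  have ha := nextProb_pos (d := d)
  induction hn : k + l generalizing i k l with
  | zero =>
    obtain ⟨rfl, rfl⟩ := Nat.add_eq_zero_iff.1 hn
    -- A visit at a positive time makes one of the counts positive.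
    have : late (0 * s) (unitStep d i) 0 0 = (∅ : Set (ℕ → Fin d ⊕ Fin d)) := by
      rw [Set.eq_empty_iff_forall_notMem]
      rintro x ⟨R, hR, hp, h0, he⟩
      obtain ⟨R, rfl⟩ := Nat.exists_eq_succ_of_ne_zero (by omega : R ≠ 0)
      rw [Nat.succ_eq_add_one, visits_succ] at h0 he
      rcases hp with hp | hp
      · rw [Nat.succ_eq_add_one] at hp; simp [hp] at h0
      · rw [Nat.succ_eq_add_one] at hp; simp [hp] at he
    rw [this]
    simp
  | succ n ih =>
    have hcast : (k : ℝ) + l = n + 1 := by exact_mod_cast hn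
    have hsub := late_subset (unitStep_ne_zero i) s (n * s) k l
    rw [show s + n * s = (n + 1) * s by ring] at hsub
    refine (measureReal_mono hsub).trans ((measureReal_union_le _ _).trans ?_)
    rw [measure_firstVisitThen_union hd i
      (measurableSet_afterZero (measurableSet_late _) _ _ _)
      (measurableSet_afterSelf (measurableSet_late _) _ _ _), pairWeight_eq _ (by omega), hcast]
    have h1 := measure_afterZero_le (F := late (n * s)) (c := n * u / nextProb d)
      (e := unitStep d i) (k := k) (l := l) fun k' hk => by
        have := ih i k' l (by omega)
        rwa [show (k' : ℝ) + l = n by exact_mod_cast (by omega : k' + l = n)] at this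
    have h2 := measure_afterSelf_le (F := late (n * s)) (c := n * u / nextProb d)
      (e := unitStep d i) (k := k) (l := l) fun l' hl => by
        have := ih i.swap l' k (by omega)
        rwa [show (l' : ℝ) + k = n by exact_mod_cast (by omega : l' + k = n),
          unitStep_swap] at this
    have h3 := measure_afterZero_le (F := reached) (c := 1) (e := unitStep d i) (k := k) (l := l)
      fun k' _ => by rw [one_mul]; exact measure_reached_le hd i k' l
    have h4 := measure_afterSelf_le (F := reached) (c := 1) (e := unitStep d i) (k := k) (l := l)
      fun l' _ => by rw [one_mul, ← unitStep_swap]; exact measure_reached_le hd i.swap l' k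
    have h5 : (pathLaw d).real (firstVisitThen (unitStep d i) 0 (Set.Ioi s)
        (afterZero reached (unitStep d i) k l)) ≤ u * pairWeightPred (nextProb d) k l := by
      rw [measure_firstVisitThen (Or.inl rfl) _
        (measurableSet_afterZero measurableSet_reached _ _ _)]
      have := (measure_firstVisitThen_late_le (unitStep d i) 0 s).trans (hu 0)
      exact mul_le_mul this (by linarith) measureReal_nonneg (measureReal_nonneg.trans this)
    have h6 : (pathLaw d).real (firstVisitThen (unitStep d i) (unitStep d i) (Set.Ioi s)
        (afterSelf reached (unitStep d i) k l)) ≤ u * pairWeightPred (nextProb d) l k := by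
      rw [measure_firstVisitThen (Or.inr rfl) _
        (measurableSet_afterSelf measurableSet_reached _ _ _)]
      have := (measure_firstVisitThen_late_le (unitStep d i) (unitStep d i) s).trans (hu _)
      exact mul_le_mul this (by linarith) measureReal_nonneg (measureReal_nonneg.trans this)
    have h7 := measureReal_union_le (μ := pathLaw d) (firstVisitThen (unitStep d i) 0 (Set.Ioi s)
        (afterZero reached (unitStep d i) k l)) (firstVisitThen (unitStep d i) (unitStep d i)
        (Set.Ioi s) (afterSelf reached (unitStep d i) k l))
    have h8 := mul_le_mul_of_nonneg_left (add_le_add h1 h2) ha.le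
    set p := pairWeightPred (nextProb d) k l
    set q := pairWeightPred (nextProb d) l k
    have e1 : nextProb d * (n * u / nextProb d * p + n * u / nextProb d * q) =
        n * u * (p + q) := by field_simp
    have e2 : (n + 1) * u / nextProb d * (nextProb d * (p + q)) = (n + 1) * u * (p + q) := by
      field_simp
    rw [e1] at h8
    rw [e2]
    linarith

lemma measure_late_le (hd : 3 ≤ d) {s : ℕ} {u : ℝ}
    (hu : ∀ z : Fin d → ℤ, (pathLaw d).real {x | ∃ m, s < m ∧ pos x m = z} ≤ u)
    (i : Fin d ⊕ Fin d) {k l R : ℕ} (hR : (k + l) * s ≤ R) :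
    (pathLaw d).real (late R (unitStep d i) k l) ≤
      (k + l) * u / nextProb d * pairWeight (nextProb d) k l :=
  (measureReal_mono (late_anti hR _ _ _)).trans (measure_late_mul_le hd hu i k l)

end Bounds

/-! ### The rate function and its comparison with the weights -/

section Rate

/-- The exponential rate of the pair of local times of two adjacent sites. -/
noncomputable def pairRate (a x y : ℝ) : ℝ :=
  -(x + y) * Real.log (x + y) + x * Real.log x + y * Real.log y - (x + y) * Real.log a

lemma pairRate_comm (a x y : ℝ) : pairRate a x y = pairRate a y x := by
  unfold pairRate; rw [add_comm x y]; ring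

/-- The `log c` terms of `x`, `y` and `x + y` cancel. This homogeneity turns dilates of the region
into sublevel sets of the rate. -/
lemma pairRate_mul (a : ℝ) {c x y : ℝ} (hc : 0 < c) (hx : 0 ≤ x) (hy : 0 ≤ y) :
    pairRate a (c * x) (c * y) = c * pairRate a x y := by
  have h : ∀ t : ℝ, 0 ≤ t → (c * t) * Real.log (c * t) = c * (t * Real.log c + t * Real.log t) := by
    intro t ht
    rcases ht.eq_or_lt with rfl | ht
    · simp
    · rw [Real.log_mul hc.ne' ht.ne']; ring
  unfold pairRate
  rw [← mul_add, neg_mul, h x hx, h y hy, h (x + y) (add_nonneg hx hy)]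
  ring

lemma mem_smul_regionB {γ c x y : ℝ} (hc : 0 < c) :
    (x, y) ∈ c • regionB γ ↔ 0 ≤ x ∧ 0 ≤ y ∧ pairRate ((1 - γ) / (2 - γ)) x y ≤ c := by
  rw [Set.mem_smul_set_iff_inv_smul_mem₀ hc.ne']
  have hi : 0 < c⁻¹ := inv_pos.2 hc
  change 0 ≤ c⁻¹ * x ∧ 0 ≤ c⁻¹ * y ∧ pairRate _ (c⁻¹ * x) (c⁻¹ * y) ≤ 1 ↔ _
  rw [mul_nonneg_iff_of_pos_left hi, mul_nonneg_iff_of_pos_left hi]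
  refine and_congr_right fun hx => and_congr_right fun hy => ?_
  rw [pairRate_mul _ hi hx hy, inv_mul_le_iff₀ hc, mul_one]

lemma eq_zero_of_mem_smul_regionB {γ c : ℝ} {k l : ℕ} (hc : c ≤ 0)
    (h : ((k : ℝ), (l : ℝ)) ∈ c • regionB γ) : k = 0 ∧ l = 0 := by
  obtain ⟨p, hp, hpe⟩ := h
  have h1 : c * p.1 = k := congrArg Prod.fst hpe
  have h2 : c * p.2 = l := congrArg Prod.snd hpe
  have h3 : (k : ℝ) ≤ 0 := h1 ▸ mul_nonpos_of_nonpos_of_nonneg hc hp.1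
  have h4 : (l : ℝ) ≤ 0 := h2 ▸ mul_nonpos_of_nonpos_of_nonneg hc hp.2.1
  exact ⟨by exact_mod_cast le_antisymm h3 k.cast_nonneg,
    by exact_mod_cast le_antisymm h4 l.cast_nonneg⟩

/-- The entropy of a two-point distribution is at most `log 2`, proved here from `log t ≤ t - 1`.
For `2a < 1` the rate therefore grows at least linearly. -/
lemma mul_add_le_pairRate {a x y : ℝ} (ha : 0 < a) (hx : 0 ≤ x) (hy : 0 ≤ y) :
    -Real.log (2 * a) * (x + y) ≤ pairRate a x y := by
  have h : ∀ s t : ℝ, 0 ≤ t → 0 ≤ s → t * (Real.log (t + s) - Real.log 2 - Real.log t) ≤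
      (t + s) / 2 - t := by
    intro s t ht hs
    rcases ht.eq_or_lt with rfl | ht
    · simpa using div_nonneg hs zero_le_two
    · rw [← Real.log_div (by positivity) (by norm_num), ← Real.log_div (by positivity) ht.ne']
      have := Real.log_le_sub_one_of_pos (x := (t + s) / 2 / t) (by positivity)
      calc t * Real.log ((t + s) / 2 / t) ≤ t * ((t + s) / 2 / t - 1) := by gcongr
        _ = (t + s) / 2 - t := by field_simp
  have h1 := h y x hx hy
  have h2 := h x y hy hx
  rw [add_comm y x] at h2
  rw [Real.log_mul (by norm_num) ha.ne', pairRate]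
  linarith

/-- `C(k+l, k) k^k l^l` is a single term in the binomial expansion of `(k+l)^(k+l)`. -/
lemma pairWeight_le_exp {a : ℝ} (ha : 0 < a) (k l : ℕ) :
    pairWeight a k l ≤ Real.exp (-pairRate a k l) := by
  have hC : 0 < (k + l).choose k := Nat.choose_pos (Nat.le_add_right k l)
  have hpow : ∀ n : ℕ, (0 : ℝ) < (n : ℝ) ^ n := fun n => by
    rcases n.eq_zero_or_pos with rfl | hn
    · simp
    · positivity
  have h : ((k + l).choose k : ℝ) * ((k : ℝ) ^ k * (l : ℝ) ^ l) ≤ ((k : ℝ) + l) ^ (k + l) := by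
    rw [add_pow]
    have := Finset.single_le_sum (f := fun m => (k : ℝ) ^ m * (l : ℝ) ^ (k + l - m) *
      ((k + l).choose m : ℝ)) (s := Finset.range (k + l + 1)) (fun m _ => by positivity)
      (Finset.mem_range.2 (by omega : k < k + l + 1))
    simp only [Nat.add_sub_cancel_left] at this
    linarith
  have hlog := Real.log_le_log (mul_pos (Nat.cast_pos.2 hC) (mul_pos (hpow k) (hpow l))) h
  rw [Real.log_mul (Nat.cast_pos.2 hC).ne' (mul_pos (hpow k) (hpow l)).ne',
    Real.log_mul (hpow k).ne' (hpow l).ne', Real.log_pow, Real.log_pow, Real.log_pow] at hlog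
  rw [← Real.log_le_iff_le_exp (pairWeight_pos ha k l), pairWeight,
    Real.log_mul (Nat.cast_pos.2 hC).ne' (by positivity), Real.log_pow, pairRate]
  push_cast at hlog ⊢
  linarith

lemma log_factorial_bounds (n : ℕ) :
    n * Real.log n - n ≤ Real.log n.factorial ∧
      Real.log n.factorial ≤ n * Real.log n - n + 2 * Real.log (n + 1) := by
  induction n with
  | zero => simp
  | succ n ih =>
    have hn1 : (0 : ℝ) < n + 1 := by positivity
    rw [Nat.factorial_succ, Nat.cast_mul, Real.log_mul (by positivity) (by positivity)]
    push_cast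
    have h1 : n * (Real.log (n + 1) - Real.log n) ≤ 1 := by
      rcases n.eq_zero_or_pos with rfl | hn
      · simp
      · have hn' : (0 : ℝ) < n := Nat.cast_pos.2 hn
        rw [← Real.log_div hn1.ne' hn'.ne']
        have := Real.log_le_sub_one_of_pos (x := ((n : ℝ) + 1) / n) (by positivity)
        calc n * Real.log ((n + 1) / n) ≤ n * ((n + 1) / n - 1) := by gcongr
          _ = 1 := by field_simp; ring
    have h2 : n / (n + 1) ≤ n * (Real.log (n + 1) - Real.log n) := by
      rcases n.eq_zero_or_pos with rfl | hn
      · simp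
      · have hn' : (0 : ℝ) < n := Nat.cast_pos.2 hn
        have := Real.log_le_sub_one_of_pos (x := (n : ℝ) / (n + 1)) (by positivity)
        rw [Real.log_div hn'.ne' hn1.ne'] at this
        calc (n : ℝ) / (n + 1) = n * (1 - n / (n + 1)) := by field_simp; ring
          _ ≤ _ := mul_le_mul_of_nonneg_left (by linarith) hn'.le
    have h3 : 1 / (n + 2 : ℝ) ≤ Real.log (n + 1 + 1) - Real.log (n + 1) := by
      have := Real.log_le_sub_one_of_pos (x := ((n : ℝ) + 1) / (n + 1 + 1)) (by positivity)
      rw [Real.log_div (by positivity) (by positivity)] at this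
      have e : ((n : ℝ) + 1) / (n + 1 + 1) - 1 = -(1 / (n + 2)) := by field_simp; ring
      linarith
    -- This inequality is what the coefficient `2` of the logarithmic error is for: its increment
    -- makes up for `n/(n+1)` falling short of `1`.
    have h4 : 1 ≤ (n : ℝ) / (n + 1) + 2 * (1 / (n + 2)) := by
      rw [div_add' _ _ _ (by positivity), le_div_iff₀ (by positivity)]
      have : (1 : ℝ) / (n + 2) * (n + 2) = 1 := by field_simp
      have h5 : (0 : ℝ) < 1 / (n + 2) := by positivity
      nlinarith
    constructor <;> nlinarith [ih.1, ih.2]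

/-- Each of the two factorials in the denominator of the binomial coefficient costs a squared
factor, hence the fourth power. -/
lemma exp_le_pairWeight {a : ℝ} (ha : 0 < a) (k l : ℕ) :
    Real.exp (-pairRate a k l) ≤ ((k : ℝ) + l + 1) ^ 4 * pairWeight a k l := by
  have hC : (0 : ℝ) < (k + l).choose k :=
    Nat.cast_pos.2 (Nat.choose_pos (Nat.le_add_right k l))
  have hfac : ((k + l).choose k : ℝ) * k.factorial * l.factorial = (k + l).factorial := by
    rw [Nat.choose_symm_add]
    exact_mod_cast Nat.add_choose_mul_factorial_mul_factorial k l
  have hlog := congrArg Real.log hfac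
  rw [Real.log_mul (by positivity) (by positivity), Real.log_mul (by positivity) (by positivity)]
    at hlog
  rw [← Real.le_log_iff_exp_le (mul_pos (by positivity) (pairWeight_pos ha k l)),
    Real.log_mul (by positivity) (pairWeight_pos ha k l).ne', pairWeight,
    Real.log_mul hC.ne' (by positivity), Real.log_pow, Real.log_pow, pairRate]
  have h1 := (log_factorial_bounds (k + l)).1
  have h2 := (log_factorial_bounds k).2
  have h3 := (log_factorial_bounds l).2
  have h4 : Real.log (k + 1) ≤ Real.log (k + l + 1) :=
    Real.log_le_log (by positivity) (by linarith [l.cast_nonneg (α := ℝ)])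
  have h5 : Real.log (l + 1) ≤ Real.log (k + l + 1) :=
    Real.log_le_log (by positivity) (by linarith [k.cast_nonneg (α := ℝ)])
  push_cast at h1 ⊢
  linarith

lemma pairWeight_le_succ {a : ℝ} (ha : 0 < a) (k l : ℕ) :
    pairWeight a k l ≤ a⁻¹ * pairWeight a (k + 1) l := by
  have h : ((k + l).choose k : ℝ) ≤ (k + l + 1).choose (k + 1) := by
    exact_mod_cast (Nat.choose_succ_succ (k + l) k).symm ▸ Nat.le_add_right _ _
  unfold pairWeight
  rw [show k + 1 + l = k + l + 1 by ring, pow_succ]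
  calc ((k + l).choose k : ℝ) * a ^ (k + l) ≤ (k + l + 1).choose (k + 1) * a ^ (k + l) := by gcongr
    _ = _ := by field_simp

end Rate

/-! ### From visit counts to total local times -/

section LocalTime

variable {d : ℕ}

/-- The total local time at `z` of the path with step labels `x`. -/
noncomputable def localTime (x : ℕ → Fin d ⊕ Fin d) (z : Fin d → ℤ) : ℕ∞ :=
  Set.encard {m : ℕ | 0 < m ∧ pos x m = z}

lemma localTime_eq {x : ℕ → Fin d ⊕ Fin d} {z : Fin d → ℤ} {N k : ℕ}
    (h : ∀ R, N ≤ R → visits x z R = k) : localTime x z = k := by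
  have hset : {m : ℕ | 0 < m ∧ pos x m = z} =
      ((Finset.Ioc 0 N).filter fun m => pos x m = z : Finset ℕ) := by
    ext m
    simp only [Set.mem_ofPred_eq, Finset.coe_filter, Finset.mem_Ioc]
    refine ⟨fun hm => ⟨⟨hm.1, ?_⟩, hm.2⟩, fun hm => ⟨hm.1.1, hm.2⟩⟩
    by_contra hlt
    obtain ⟨m, rfl⟩ := Nat.exists_eq_succ_of_ne_zero hm.1.ne'
    have h1 := h m (by omega)
    have h2 := h (m + 1) (by omega)
    rw [visits_succ, h1, if_pos hm.2] at h2
    omega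
  rw [localTime, hset, Set.encard_coe_eq_coe_finsetCard, ← h N le_rfl, visits]

lemma exists_visits_eventually_eq {x : ℕ → Fin d ⊕ Fin d} {z : Fin d → ℤ}
    (h : ∀ᶠ m in Filter.atTop, pos x m ≠ z) : ∃ N k, ∀ R, N ≤ R → visits x z R = k := by
  obtain ⟨N, hN⟩ := Filter.eventually_atTop.1 h
  refine ⟨N, visits x z N, fun R hR => ?_⟩
  induction R, hR using Nat.le_induction with
  | base => rfl
  | succ R hR ih => rw [visits_succ, ih, if_neg (hN _ (by omega)), add_zero]

lemma localTimes_of_shift_mem_total {x : ℕ → Fin d ⊕ Fin d} {e : Fin d → ℤ} {j a b k l : ℕ}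
    (ha : visits x (pos x j) j = a) (hb : visits x (pos x j + e) j = b)
    (h : shift j x ∈ total e k l) :
    localTime x (pos x j) = (a + k : ℕ) ∧ localTime x (pos x j + e) = (b + l : ℕ) := by
  obtain ⟨N, hN⟩ := h
  refine ⟨localTime_eq (N := j + N) fun R hR => ?_, localTime_eq (N := j + N) fun R hR => ?_⟩
  · obtain ⟨r, rfl⟩ := Nat.exists_eq_add_of_le (le_of_add_le_left hR)
    rw [visits_add, ha, sub_self, (hN r (by omega)).1]
  · obtain ⟨r, rfl⟩ := Nat.exists_eq_add_of_le (le_of_add_le_left hR)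
    rw [visits_add, hb, add_sub_cancel_left, (hN r (by omega)).2]

lemma exists_first_time {x : ℕ → Fin d ⊕ Fin d} {e : Fin d → ℤ} (j : ℕ) :
    ∃ m ≤ j, (pos x m = pos x j ∨ pos x m = pos x j + e) ∧
      ∀ r < m, pos x r ≠ pos x j ∧ pos x r ≠ pos x j + e := by
  classical
  have hex : ∃ m, pos x m = pos x j ∨ pos x m = pos x j + e := ⟨j, Or.inl rfl⟩
  exact ⟨Nat.find hex, Nat.find_min' hex (Or.inl rfl), Nat.find_spec hex,
    fun r hr => by have := Nat.find_min hex hr; tauto⟩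

lemma visits_eq_zero_of_forall_ne {x : ℕ → Fin d ⊕ Fin d} {z : Fin d → ℤ} {R : ℕ}
    (h : ∀ r, r ≤ R → pos x r ≠ z) : visits x z R = 0 := by
  rw [visits, Finset.card_eq_zero, Finset.filter_eq_empty_iff]
  exact fun r hr => h r (Finset.mem_Ioc.1 hr).2

/-- The arrival at time `m` is itself a visit, hence `k + 1`. Positivity of `m` matters: the
starting position at time `0` is not counted. -/
lemma localTimes_at_new_site {x : ℕ → Fin d ⊕ Fin d} {e : Fin d → ℤ} (he : e ≠ 0) {m k l : ℕ}
    (hm : 0 < m) (h : ∀ r < m, pos x r ≠ pos x m ∧ pos x r ≠ pos x m + e)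
    (ht : shift m x ∈ total e k l) :
    localTime x (pos x m) = (k + 1 : ℕ) ∧ localTime x (pos x m + e) = (l : ℕ) := by
  have h1 : visits x (pos x m) m = 1 := by
    obtain ⟨m, rfl⟩ := Nat.exists_eq_succ_of_ne_zero hm.ne'
    rw [Nat.succ_eq_add_one, visits_succ, if_pos rfl,
      visits_eq_zero_of_forall_ne fun r hr => (h r (Nat.lt_succ_of_le hr)).1]
  have h2 : visits x (pos x m + e) m = 0 := by
    refine visits_eq_zero_of_forall_ne fun r hr => ?_
    rcases hr.lt_or_eq with hr | rfl
    · exact (h r hr).2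
    · simpa using he
  have := localTimes_of_shift_mem_total h1 h2 ht
  rwa [add_comm 1 k, zero_add] at this

end LocalTime

/-! ### The upper bound -/

section UpperBound

variable {d : ℕ} [NeZero d]

/-- Exponential tail bound for the rate of the pair of local times. -/
lemma exists_measure_rate_gt_le (hd : 3 ≤ d) {δ : ℝ} (hδ : 0 < δ) (hδ1 : δ ≤ 1) :
    ∃ K : ℝ, ∀ (i : Fin d ⊕ Fin d) (t : ℝ),
      (pathLaw d).real {x | ∃ k l : ℕ, x ∈ total (unitStep d i) k l ∧
        t < pairRate (nextProb d) (k + 1 : ℕ) l} ≤ K * Real.exp (-(1 - δ) * t) := by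
  set a := nextProb d
  have ha : 0 < a := nextProb_pos
  have hc0 : 0 < -Real.log (2 * a) :=
    neg_pos.2 (Real.log_neg (by positivity) (two_mul_nextProb_lt_one hd))
  set c := -Real.log (2 * a) * δ
  have hc : 0 < c := mul_pos hc0 hδ
  have hgeo : Summable fun k : ℕ => Real.exp (-c * k) := by
    have := Real.summable_exp_nat_mul_iff.2 (neg_neg_of_pos hc)
    simpa [mul_comm] using this
  have hsum : Summable fun p : ℕ × ℕ => Real.exp (-c * p.1) * Real.exp (-c * p.2) :=
    hgeo.mul_of_nonneg hgeo (fun _ => (Real.exp_pos _).le) fun _ => (Real.exp_pos _).le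
  refine ⟨a⁻¹ * ∑' p : ℕ × ℕ, Real.exp (-c * p.1) * Real.exp (-c * p.2), fun i t => ?_⟩
  have hset : {x : ℕ → Fin d ⊕ Fin d | ∃ k l : ℕ, x ∈ total (unitStep d i) k l ∧
        t < pairRate a (k + 1 : ℕ) l} =
      ⋃ p : ℕ × ℕ, {x | x ∈ total (unitStep d i) p.1 p.2 ∧ t < pairRate a (p.1 + 1 : ℕ) p.2} := by
    ext; simp
  rw [hset, mul_right_comm, ← tsum_mul_left]
  refine measureReal_iUnion_le_tsum (fun p => ?_) (hsum.mul_left _)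
  obtain ⟨k, l⟩ := p
  by_cases ht : t < pairRate a (k + 1 : ℕ) l
  swap
  · simp only [ht, and_false, Set.ofPred_false, measureReal_empty]
    positivity
  simp only [ht, and_true, Set.ofPred_mem_eq]
  have hsub : total (unitStep d i) k l ⊆ reached (unitStep d i) k l :=
    fun x ⟨N, hN⟩ => ⟨N, hN N le_rfl⟩
  have h1 : (pathLaw d).real (total (unitStep d i) k l) ≤
      a⁻¹ * Real.exp (-pairRate a (k + 1 : ℕ) l) :=
    (measureReal_mono hsub).trans <| (measure_reached_le hd i k l).trans <|
      (pairWeight_le_succ ha k l).trans <|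
      mul_le_mul_of_nonneg_left (pairWeight_le_exp ha _ _) (by positivity)
  refine h1.trans ?_
  rw [mul_assoc]
  refine mul_le_mul_of_nonneg_left ?_ (by positivity)
  rw [← Real.exp_add, ← Real.exp_add]
  refine Real.exp_le_exp.2 ?_
  have h2 := mul_add_le_pairRate ha (x := (k + 1 : ℕ)) (y := l) (by positivity) (by positivity)
  -- A fraction `δ` of the rate pays for the sum over `(k, l)`; the remaining `1 - δ` gives the
  -- decay in `t`.
  have h3 : c * (k + l) ≤ δ * pairRate a (k + 1 : ℕ) l := by
    rw [show c = δ * -Real.log (2 * a) from mul_comm _ _, mul_assoc]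
    refine mul_le_mul_of_nonneg_left (le_trans ?_ h2) hδ.le
    push_cast
    nlinarith
  nlinarith

/-- The pairs of local times of adjacent sites visited up to time `n` eventually satisfy the
upper bound. -/
theorem ae_localTime_rate_le (hd : 3 ≤ d) {ε : ℝ} (hε : 0 < ε) :
    ∀ᵐ x ∂(pathLaw d), ∃ n₀ : ℕ, ∀ n : ℕ, n₀ ≤ n → ∀ j ≤ n, ∀ i : Fin d ⊕ Fin d, ∃ a b : ℕ,
      localTime x (pos x j) = a ∧ localTime x (pos x j + unitStep d i) = b ∧
        pairRate (nextProb d) a b ≤ (1 + ε) * Real.log n := by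
  -- Chosen so that `(1-δ)(1+ε) = 1 + ε/2`, an exponent for which the series over `j` converges.
  set δ := ε / (2 * (1 + ε)) with hδ
  have hδ0 : 0 < δ := by positivity
  have hδ1 : δ ≤ 1 := by rw [hδ, div_le_one (by positivity)]; linarith
  have hexp : (1 - δ) * (1 + ε) = 1 + ε / 2 := by rw [hδ]; field_simp; ring
  obtain ⟨K, hK⟩ := exists_measure_rate_gt_le hd hδ0 hδ1
  have hsum : Summable fun j : ℕ => K * ((j : ℝ)) ^ (-(1 + ε / 2)) :=
    (Real.summable_nat_rpow.2 (by linarith)).mul_left K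
  have hbad : ∀ i : Fin d ⊕ Fin d, ∀ᵐ x ∂(pathLaw d), ∀ᶠ j : ℕ in Filter.atTop,
      ∀ k l : ℕ, shift (j + 1) x ∈ total (unitStep d i) k l →
        pairRate (nextProb d) (k + 1 : ℕ) l ≤ (1 + ε) * Real.log (j + 1 : ℕ) := fun i => by
    have h := ae_eventually_notMem_of_summable (μ := pathLaw d)
      (A := fun j : ℕ => shift (j + 1) ⁻¹' {x | ∃ k l : ℕ, x ∈ total (unitStep d i) k l ∧
        (1 + ε) * Real.log (j + 1 : ℕ) < pairRate (nextProb d) (k + 1 : ℕ) l})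
      (fun j => ?_) ((summable_nat_add_iff 1).2 hsum)
    · filter_upwards [h] with x hx
      filter_upwards [hx] with j hj k l hkl
      by_contra! hlt
      exact hj ⟨k, l, hkl, hlt⟩
    · rw [measure_shift_preimage]
      · refine (hK i _).trans (le_of_eq ?_)
        have hj : (0 : ℝ) < (j + 1 : ℕ) := by positivity
        rw [Real.rpow_def_of_pos hj, ← mul_assoc, neg_mul, hexp, mul_comm (Real.log _)]
      · have : {x | ∃ k l : ℕ, x ∈ total (unitStep d i) k l ∧
            (1 + ε) * Real.log (j + 1 : ℕ) < pairRate (nextProb d) (k + 1 : ℕ) l} =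
            ⋃ k : ℕ, ⋃ l : ℕ, ⋃ _ : (1 + ε) * Real.log (j + 1 : ℕ) <
              pairRate (nextProb d) (k + 1 : ℕ) l, total (unitStep d i) k l := by
          ext; simp [and_comm]
        rw [this]
        exact .iUnion fun k => .iUnion fun l => .iUnion fun _ => measurableSet_total _ _ _
  have hfin : ∀ᵐ x ∂(pathLaw d), ∀ z : Fin d → ℤ, ∀ᶠ m in Filter.atTop, pos x m ≠ z :=
    ae_all_iff.2 fun z => ae_eventually_pos_ne hd z
  filter_upwards [ae_all_iff.2 hbad, hfin] with x hx hxfin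
  have hloc : ∀ z, ∃ k : ℕ, localTime x z = k := fun z => by
    obtain ⟨N, k, hk⟩ := exists_visits_eventually_eq (hxfin z)
    exact ⟨k, localTime_eq hk⟩
  choose ξ hξ using hloc
  have htot : ∀ m e, ∃ k l, shift m x ∈ total e k l := fun m e => by
    have hsh : ∀ z, ∀ᶠ r in Filter.atTop, pos (shift m x) r ≠ z := fun z => by
      obtain ⟨N, hN⟩ := Filter.eventually_atTop.1 (hxfin (pos x m + z))
      refine Filter.eventually_atTop.2 ⟨N, fun r hr hz => hN (m + r) (by omega) ?_⟩
      rw [pos_add, hz]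
    obtain ⟨N, k, hk⟩ := exists_visits_eventually_eq (hsh 0)
    obtain ⟨N', l, hl⟩ := exists_visits_eventually_eq (hsh e)
    exact ⟨k, l, max N N', fun R hR =>
      ⟨hk R ((le_max_left _ _).trans hR), hl R ((le_max_right _ _).trans hR)⟩⟩
  obtain ⟨J, hJ⟩ := Filter.eventually_atTop.1 (Filter.eventually_all.2 hx)
  set c : ℕ → Fin d ⊕ Fin d → ℝ := fun j i =>
    pairRate (nextProb d) (ξ (pos x j)) (ξ (pos x j + unitStep d i)) with hc
  -- The times up to `J`, including the uncounted time `0`, contribute finitely many finite rates,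
  -- which `(1+ε) log n` eventually exceeds.
  obtain ⟨B, hB⟩ : ∃ B : ℝ, ∀ j ≤ J, ∀ i, c j i ≤ B := by
    obtain ⟨B, hB⟩ := (((Set.finite_Iic J).prod (Set.finite_univ (α := Fin d ⊕ Fin d))).image
      fun p => c p.1 p.2).bddAbove
    exact ⟨B, fun j hj i => hB ⟨(j, i), ⟨hj, trivial⟩, rfl⟩⟩
  have hlog : Filter.Tendsto (fun n : ℕ => (1 + ε) * Real.log n) Filter.atTop Filter.atTop :=
    (Real.tendsto_log_atTop.comp tendsto_natCast_atTop_atTop).const_mul_atTop (by linarith)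
  obtain ⟨n₀, hn₀⟩ := Filter.eventually_atTop.1 (hlog.eventually_ge_atTop B)
  have hfirst : ∀ n, n₀ ≤ n → ∀ m ≤ n, ∀ i,
      (∀ r < m, pos x r ≠ pos x m ∧ pos x r ≠ pos x m + unitStep d i) →
      c m i ≤ (1 + ε) * Real.log n := by
    intro n hn m hm i hnew
    rcases le_or_gt m J with hmJ | hmJ
    · exact (hB m hmJ i).trans (hn₀ n hn)
    · obtain ⟨k, l, hkl⟩ := htot m (unitStep d i)
      obtain ⟨h1, h2⟩ := localTimes_at_new_site (unitStep_ne_zero i) (by omega) hnew hkl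
      rw [hξ] at h1 h2
      have h1' : ξ (pos x m) = k + 1 := by exact_mod_cast h1
      have h2' : ξ (pos x m + unitStep d i) = l := by exact_mod_cast h2
      obtain ⟨m, rfl⟩ := Nat.exists_eq_succ_of_ne_zero (by omega : m ≠ 0)
      have := hJ m (by omega) i k l hkl
      simp only [hc]
      rw [h1', h2']
      refine this.trans (mul_le_mul_of_nonneg_left ?_ (by linarith))
      exact Real.log_le_log (by positivity) (by exact_mod_cast hm)
  refine ⟨n₀, fun n hn j hj i => ⟨_, _, hξ _, hξ _, ?_⟩⟩
  -- The pair is examined when first met. If it is entered through the neighbour, the direction is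
  -- reversed, which the symmetry of the rate permits.
  obtain ⟨m, hmj, hm, hmin⟩ := exists_first_time (x := x) (e := unitStep d i) j
  rcases hm with hm | hm
  · rw [← hm] at hmin ⊢
    exact hfirst n hn m (hmj.trans hj) i hmin
  · have hj' : pos x j = pos x m + unitStep d i.swap := by
      rw [hm, unitStep_swap, add_neg_cancel_right]
    rw [← hm, hj'] at hmin ⊢
    rw [pairRate_comm]
    exact hfirst n hn m (hmj.trans hj) i.swap fun r hr => (hmin r hr).symm

end UpperBound

/-! ### Independent blocks for the lower bound -/

section Blocks

variable {d : ℕ}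

/-- The site at time `j` and its translate by `e` are not visited during the times `r` with
`N ≤ r < j`. -/
def newSince (N j : ℕ) (e : Fin d → ℤ) : Set (ℕ → Fin d ⊕ Fin d) :=
  {x | ∀ r, N ≤ r → r < j → pos x r ≠ pos x j ∧ pos x r ≠ pos x j + e}

/-- The numbers of visits to `0` and `e` up to time `R` are `k` and `l`. -/
def window (R : ℕ) (e : Fin d → ℤ) (k l : ℕ) : Set (ℕ → Fin d ⊕ Fin d) :=
  {x | visits x 0 R = k ∧ visits x e R = l}

/-- The site at time `R` and its translate by `e` are new, and are visited `k` and `l` times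
during the following `R` steps. -/
def success (R : ℕ) (e : Fin d → ℤ) (k l : ℕ) : Set (ℕ → Fin d ⊕ Fin d) :=
  newSince 0 R e ∩ shift R ⁻¹' window R e k l

lemma determinedBy_window (R : ℕ) (e : Fin d → ℤ) (k l : ℕ) :
    DeterminedBy R (window R e k l) :=
  determinedBy_visits 0 e R k l

lemma determinedBy_newSince (N j : ℕ) (e : Fin d → ℤ) : DeterminedBy j (newSince N j e) := by
  intro x y hxy hx r hr hrj
  rw [← pos_congr hxy le_rfl, ← pos_congr hxy hrj.le]
  exact hx r hr hrj

lemma determinedBy_success (R : ℕ) (e : Fin d → ℤ) (k l : ℕ) :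
    DeterminedBy (R + R) (success R e k l) :=
  ((determinedBy_newSince 0 R e).mono (Nat.le_add_right R R)).inter
    ((determinedBy_window R e k l).shift_preimage R)

/-- If the final counts are not yet present at time `R`, the first later time at which they are is a
visit, and a late one. -/
lemma total_diff_late_subset (R : ℕ) (e : Fin d → ℤ) (k l : ℕ) :
    total e k l \ late R e k l ⊆ window R e k l := by
  rintro x ⟨⟨N, hN⟩, hlate⟩
  by_contra hw
  classical
  have hex : ∃ r, visits x 0 (R + r) = k ∧ visits x e (R + r) = l := ⟨N, hN _ (by omega)⟩
  have hspec := Nat.find_spec hex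
  have hne : Nat.find hex ≠ 0 := fun h0 => by
    rw [h0, add_zero] at hspec; exact hw hspec
  obtain ⟨r, hr⟩ := Nat.exists_eq_succ_of_ne_zero hne
  have hmin := Nat.find_min hex (m := r) (by omega)
  rw [hr, Nat.succ_eq_add_one, ← add_assoc] at hspec
  refine hlate ⟨R + r + 1, by omega, ?_, hspec⟩
  by_contra! hp
  rw [visits_succ, visits_succ, if_neg hp.1, if_neg hp.2] at hspec
  exact hmin hspec

/-- A path that has `k` and `l` visits up to time `R` either has no visits later or has one of two
larger pairs of numbers of visits at a late visit. -/
lemma window_subset {e : Fin d → ℤ} (he : e ≠ 0) (R k l : ℕ) :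
    window R e k l ⊆ total e k l ∪ (late R e (k + 1) l ∪ late R e k (l + 1)) := by
  rintro x ⟨hk, hl⟩
  by_contra hx
  simp only [Set.mem_union, not_or] at hx
  obtain ⟨htot, h1, h2⟩ := hx
  refine htot ⟨R, fun r hr => ?_⟩
  induction r, hr using Nat.le_induction with
  | base => exact ⟨hk, hl⟩
  | succ r hr ih =>
    have hp0 : pos x (r + 1) ≠ 0 := fun hp => h1 ⟨r + 1, by omega, Or.inl hp, by
      rw [visits_succ, if_pos hp, ih.1], by
      rw [visits_succ, if_neg (by rw [hp]; exact he.symm), ih.2, add_zero]⟩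
    have hpe : pos x (r + 1) ≠ e := fun hp => h2 ⟨r + 1, by omega, Or.inr hp, by
      rw [visits_succ, if_neg (by rw [hp]; exact he), ih.1, add_zero], by
      rw [visits_succ, if_pos hp, ih.2]⟩
    rw [visits_succ, visits_succ, if_neg hp0, if_neg hpe]
    exact ih

/-- Reversal of the first `j` steps. -/
def reverseIndex (j : ℕ) (m : ℕ) : ℕ := if m < j then j - 1 - m else m

lemma reverseIndex_injective (j : ℕ) : Function.Injective (reverseIndex j) := by
  intro m n h
  unfold reverseIndex at h
  split_ifs at h <;> omega

lemma pos_reverse (x : ℕ → Fin d ⊕ Fin d) {j m : ℕ} (hm : m ≤ j) :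
    pos (fun n => x (reverseIndex j n)) m = pos x j - pos x (j - m) := by
  induction m with
  | zero => simp
  | succ m ih =>
    have h := pos_succ x (j - (m + 1))
    rw [show j - (m + 1) + 1 = j - m by omega] at h
    rw [pos_succ, ih (by omega), h, reverseIndex, if_pos (by omega),
      show j - 1 - m = j - (m + 1) by omega]
    abel

/-- Looking back from time `j`, the reversed path must avoid `0` and `-e`. The reversed path has the
same law, so the past is estimated like the future. -/
lemma newSince_zero_eq (j : ℕ) (e : Fin d → ℤ) :
    newSince 0 j e = (fun x n => x (reverseIndex j n)) ⁻¹' window j (-e) 0 0 := by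
  ext x
  simp only [newSince, window, Set.mem_ofPred_eq, Set.mem_preimage]
  simp only [visits, Finset.card_eq_zero, Finset.filter_eq_empty_iff, Finset.mem_Ioc]
  constructor
  · refine fun h => ⟨fun m hm hp => ?_, fun m hm hp => ?_⟩ <;> rw [pos_reverse x hm.2] at hp
    · exact (h (j - m) (by omega) (by omega)).1 (sub_eq_zero.1 hp).symm
    · exact (h (j - m) (by omega) (by omega)).2 (by rw [sub_eq_iff_eq_add] at hp; rw [hp]; abel)
  · rintro ⟨h1, h2⟩ r _ hr
    have hp := pos_reverse x (j := j) (m := j - r) (by omega)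
    rw [Nat.sub_sub_self hr.le] at hp
    refine ⟨fun h => h1 (x := j - r) (by omega) ?_, fun h => h2 (x := j - r) (by omega) ?_⟩
    · rw [hp, h, sub_self]
    · rw [hp, h]; abel

lemma compl_newSince_subset (N j : ℕ) (e : Fin d → ℤ) {s : ℕ} (hs : N + s ≤ j) :
    {x | ∃ r < N, pos x r = pos x j ∨ pos x r = pos x j + e} ⊆
      (fun x n => x (reverseIndex j n)) ⁻¹'
        ({x | ∃ m, s < m ∧ pos x m = 0} ∪ {x | ∃ m, s < m ∧ pos x m = -e}) := by
  rintro x ⟨r, hr, h⟩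
  have hp := pos_reverse x (j := j) (m := j - r) (by omega)
  rw [Nat.sub_sub_self (by omega)] at hp
  rcases h with h | h
  · exact Or.inl ⟨j - r, by omega, by rw [hp, h, sub_self]⟩
  · exact Or.inr ⟨j - r, by omega, by rw [hp, h]; abel⟩

lemma measurableSet_late_visit (s : ℕ) (z : Fin d → ℤ) :
    MeasurableSet {x | ∃ m, s < m ∧ pos x m = z} := by
  have : {x | ∃ m, s < m ∧ pos x m = z} = ⋃ m, ⋃ _ : s < m, {x | pos x m = z} := by ext; simp
  rw [this]
  exact .iUnion fun m => .iUnion fun _ => measurableSet_pos_eq m z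

lemma determinedBy_revisit (N j : ℕ) (hN : N ≤ j) (e : Fin d → ℤ) :
    DeterminedBy j {x | ∃ r < N, pos x r = pos x j ∨ pos x r = pos x j + e} := by
  rintro x y hxy ⟨r, hr, h⟩
  refine ⟨r, hr, ?_⟩
  rwa [← pos_congr hxy le_rfl, ← pos_congr hxy (hr.le.trans hN)]

variable [NeZero d]

lemma le_measure_newSince (hd : 3 ≤ d) (i : Fin d ⊕ Fin d) (j : ℕ) :
    1 - 2 * nextProb d ≤ (pathLaw d).real (newSince 0 j (unitStep d i)) := by
  rw [newSince_zero_eq, measure_reindex_preimage (reverseIndex_injective j)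
    (determinedBy_window _ _ _ _).measurableSet, ← unitStep_swap]
  have h := le_measure_total hd i.swap 0 0
  simp only [pairWeight, add_zero, Nat.choose_self, Nat.cast_one, pow_zero, mul_one] at h
  refine h.trans (measureReal_mono ?_)
  rintro x ⟨N, hN⟩
  obtain ⟨h1, h2⟩ := hN (max N j) (le_max_left _ _)
  exact ⟨Nat.le_zero.1 (h1 ▸ visits_mono x _ (le_max_right N j)),
    Nat.le_zero.1 (h2 ▸ visits_mono x _ (le_max_right N j))⟩

/-- One factor `1 - 2α` comes from the past, independent of the future. The other comes from
`total`, of which `late` removes at most half by the smallness of `u`. -/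
lemma le_measure_success (hd : 3 ≤ d) (i : Fin d ⊕ Fin d) {k l s : ℕ} {u : ℝ}
    (hu : ∀ z : Fin d → ℤ, (pathLaw d).real {x | ∃ m, s < m ∧ pos x m = z} ≤ u)
    (hsmall : (k + l + 1) * u ≤ nextProb d * (1 - 2 * nextProb d) / 2) :
    (1 - 2 * nextProb d) ^ 2 / 2 * pairWeight (nextProb d) k l ≤
      (pathLaw d).real (success ((k + l + 1) * s) (unitStep d i) k l) := by
  have ha := nextProb_pos (d := d)
  have ha1 := two_mul_nextProb_lt_one hd
  have hw := pairWeight_pos ha k l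
  have hu0 : 0 ≤ u := measureReal_nonneg.trans (hu 0)
  set R := (k + l + 1) * s
  have hm : MeasurableSet (window R (unitStep d i) k l) :=
    (determinedBy_window _ _ _ _).measurableSet
  rw [success, measure_inter_shift_preimage (determinedBy_newSince _ _ _) hm]
  have h1 := le_measure_newSince hd i R
  have h2 : (1 - 2 * nextProb d) / 2 * pairWeight (nextProb d) k l ≤
      (pathLaw d).real (window R (unitStep d i) k l) := by
    refine le_trans ?_ (measureReal_mono (total_diff_late_subset R (unitStep d i) k l))
    refine le_trans ?_ (le_measureReal_sdiff)
    have h3 := le_measure_total hd i k l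
    have h4 := measure_late_le hd hu i (k := k) (l := l) (R := R)
      (Nat.mul_le_mul_right s (Nat.le_succ _))
    have h5 : (k + l) * u / nextProb d ≤ (1 - 2 * nextProb d) / 2 := by
      rw [div_le_iff₀ ha]; linarith
    have h6 := mul_le_mul_of_nonneg_right h5 hw.le
    linarith
  have h7 := mul_le_mul h1 h2 (by nlinarith) measureReal_nonneg
  refine le_trans (le_of_eq ?_) h7
  ring

/-- No success in the first `m` blocks. -/
lemma measure_no_success (R : ℕ) (e : Fin d → ℤ) (k l m : ℕ) :
    (pathLaw d).real {x | ∀ b < m, shift (b * (R + R)) x ∉ success R e k l} =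
      (1 - (pathLaw d).real (success R e k l)) ^ m ∧
    DeterminedBy (m * (R + R)) {x | ∀ b < m, shift (b * (R + R)) x ∉ success R e k l} := by
  have hS := determinedBy_success R e k l
  induction m with
  | zero => simp [DeterminedBy]
  | succ m ih =>
    have hset : {x | ∀ b < m + 1, shift (b * (R + R)) x ∉ success R e k l} =
        {x | ∀ b < m, shift (b * (R + R)) x ∉ success R e k l} ∩
          shift (m * (R + R)) ⁻¹' (success R e k l)ᶜ := by
      ext x
      simp only [Set.mem_ofPred_eq, Set.mem_inter_iff, Set.mem_preimage, Set.mem_compl_iff,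
        Nat.lt_succ_iff_lt_or_eq]
      exact ⟨fun h => ⟨fun b hb => h b (Or.inl hb), h m (Or.inr rfl)⟩, fun h b hb =>
        hb.elim (h.1 b) fun hb => hb ▸ h.2⟩
    rw [hset]
    constructor
    · rw [measure_inter_shift_preimage ih.2 hS.measurableSet.compl, ih.1,
        probReal_compl_eq_one_sub hS.measurableSet, pow_succ]
    · rw [add_mul, one_mul]
      exact (ih.2.mono (Nat.le_add_right _ _)).inter (hS.compl.shift_preimage _)

/-- The probability that the site at time `N + R` shows `k` and `l` visits within `R` steps, but
that it or its translate is visited before time `N` or after time `N + 2R`. -/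
lemma measure_spoiled_le (hd : 3 ≤ d) (i : Fin d ⊕ Fin d) {k l s : ℕ} {u : ℝ}
    (hu : ∀ z : Fin d → ℤ, (pathLaw d).real {x | ∃ m, s < m ∧ pos x m = z} ≤ u) (N : ℕ) :
    (pathLaw d).real (shift (N + (k + l + 1) * s) ⁻¹' (late ((k + l + 1) * s) (unitStep d i)
        (k + 1) l ∪ late ((k + l + 1) * s) (unitStep d i) k (l + 1)) ∪
      ({x | ∃ r < N, pos x r = pos x (N + (k + l + 1) * s) ∨
        pos x r = pos x (N + (k + l + 1) * s) + unitStep d i} ∩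
        shift (N + (k + l + 1) * s) ⁻¹' window ((k + l + 1) * s) (unitStep d i) k l)) ≤
      (2 / nextProb d + 2) * (k + l + 1) ^ 2 * u * pairWeight (nextProb d) k l := by
  have ha := nextProb_pos (d := d)
  have ha1 := two_mul_nextProb_lt_one hd
  have hw := pairWeight_pos ha k l
  have hu0 : 0 ≤ u := measureReal_nonneg.trans (hu 0)
  set R := (k + l + 1) * s with hR
  set e := unitStep d i
  set a := nextProb d
  have hL : (1 : ℝ) ≤ k + l + 1 := by linarith [k.cast_nonneg (α := ℝ), l.cast_nonneg (α := ℝ)]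
  -- Increasing one count multiplies the weight by at most `k+l+1`, so the bound remains
  -- proportional to the weight of `(k, l)`; otherwise the sum over the blocks would not be small.
  have h1 : (pathLaw d).real (late R e (k + 1) l) ≤
      (k + l + 1) * u / a * ((k + l + 1) * pairWeight a k l) := by
    have h := measure_late_le hd hu i (k := k + 1) (l := l) (R := R)
      (le_of_eq (by rw [hR]; ring))
    refine h.trans ?_
    rw [show ((k + 1 : ℕ) : ℝ) + l = k + l + 1 by push_cast; ring]
    exact mul_le_mul_of_nonneg_left (pairWeight_succ_left_le ha (by linarith) k l) (by positivity)
  have h2 : (pathLaw d).real (late R e k (l + 1)) ≤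
      (k + l + 1) * u / a * ((k + l + 1) * pairWeight a k l) := by
    have h := measure_late_le hd hu i (k := k) (l := l + 1) (R := R)
      (le_of_eq (by rw [hR]; ring))
    refine h.trans ?_
    rw [show (k : ℝ) + (l + 1 : ℕ) = k + l + 1 by push_cast; ring]
    exact mul_le_mul_of_nonneg_left (pairWeight_succ_right_le ha (by linarith) k l) (by positivity)
  have h3 : (pathLaw d).real {x | ∃ r < N, pos x r = pos x (N + R) ∨ pos x r = pos x (N + R) + e} ≤
      2 * u := by
    have hsR : s ≤ R := Nat.le_mul_of_pos_left s (Nat.succ_pos _)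
    refine (measureReal_mono (compl_newSince_subset N (N + R) e (s := s) (by omega))).trans ?_
    rw [measure_reindex_preimage (reverseIndex_injective _)
      ((measurableSet_late_visit s 0).union (measurableSet_late_visit s (-e)))]
    refine (measureReal_union_le _ _).trans ?_
    linarith [hu 0, hu (-e)]
  have hm : MeasurableSet (window R e k l) := (determinedBy_window _ _ _ _).measurableSet
  have h4 : (pathLaw d).real (window R e k l) ≤ pairWeight a k l :=
    (measureReal_mono fun x (hx : x ∈ window R e k l) => (⟨R, hx⟩ : x ∈ reached e k l)).trans
      (measure_reached_le hd i k l)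
  refine (measureReal_union_le _ _).trans ?_
  rw [measure_shift_preimage _ ((measurableSet_late _ _ _ _).union (measurableSet_late _ _ _ _)),
    measure_inter_shift_preimage (determinedBy_revisit N (N + R) (Nat.le_add_right _ _) e) hm]
  have h5 := mul_le_mul h3 h4 measureReal_nonneg (by positivity)
  have h6 := measureReal_union_le (μ := pathLaw d) (late R e (k + 1) l) (late R e k (l + 1))
  have h7 : 2 * u * pairWeight a k l ≤ 2 * u * pairWeight a k l * (k + l + 1) ^ 2 :=
    le_mul_of_one_le_right (by positivity) (one_le_pow₀ hL)
  calc _ ≤ 2 * ((k + l + 1) * u / a * ((k + l + 1) * pairWeight a k l)) +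
        2 * u * pairWeight a k l * (k + l + 1) ^ 2 := by linarith
    _ = _ := by ring

/-- The probability that no site shows the prescribed pair of local times. -/
lemma measure_forall_not_localTimes_le (hd : 3 ≤ d) (i : Fin d ⊕ Fin d) {k l s m n : ℕ} {u : ℝ}
    (hs : 0 < s)
    (hu : ∀ z : Fin d → ℤ, (pathLaw d).real {x | ∃ m, s < m ∧ pos x m = z} ≤ u)
    (hsmall : (k + l + 1) * u ≤ nextProb d * (1 - 2 * nextProb d) / 2)
    (hn : m * ((k + l + 1) * s + (k + l + 1) * s) ≤ n) :
    (pathLaw d).real {x | ¬∃ j ≤ n, localTime x (pos x j) = (k + 1 : ℕ) ∧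
        localTime x (pos x j + unitStep d i) = (l : ℕ)} ≤
      Real.exp (-((1 - 2 * nextProb d) ^ 2 / 2 * (m * pairWeight (nextProb d) k l))) +
      (2 / nextProb d + 2) * (k + l + 1) ^ 2 * u * (m * pairWeight (nextProb d) k l) := by
  set R := (k + l + 1) * s with hR
  have hRpos : 0 < R := by positivity
  set e := unitStep d i with he
  set a := nextProb d
  let bad : ℕ → Set (ℕ → Fin d ⊕ Fin d) := fun b =>
    shift (b * (R + R) + R) ⁻¹' (late R e (k + 1) l ∪ late R e k (l + 1)) ∪
      ({x | ∃ r < b * (R + R), pos x r = pos x (b * (R + R) + R) ∨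
        pos x r = pos x (b * (R + R) + R) + e} ∩
        shift (b * (R + R) + R) ⁻¹' window R e k l)
  -- A success in an unspoiled block is a pair of sites that is new for the whole path and never
  -- visited after the block, so its total local times are as prescribed.
  have hsub : {x | ¬∃ j ≤ n, localTime x (pos x j) = (k + 1 : ℕ) ∧
        localTime x (pos x j + e) = (l : ℕ)} ⊆
      {x | ∀ b < m, shift (b * (R + R)) x ∉ success R e k l} ∪
        ⋃ b ∈ Finset.range m, bad b := by
    intro x hx
    by_contra hcon
    simp only [Set.mem_union, Set.mem_iUnion, not_or, Finset.mem_range, not_exists,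
      Set.mem_ofPred_eq, not_forall, not_not] at hcon
    obtain ⟨⟨b, hb, hnew, hwin⟩, hbad⟩ := hcon
    have hgood := hbad b hb
    simp only [bad, Set.mem_union, not_or, Set.mem_inter_iff, not_and] at hgood
    rw [Set.mem_preimage, shift_shift] at hwin
    have hold : ∀ r < b * (R + R), pos x r ≠ pos x (b * (R + R) + R) ∧
        pos x r ≠ pos x (b * (R + R) + R) + e := fun r hr => by
      have h := fun h => hgood.2 h hwin
      simp only [Set.mem_ofPred_eq] at h
      by_contra hc
      refine h ⟨r, hr, ?_⟩
      tauto
    have htot : shift (b * (R + R) + R) x ∈ total e k l :=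
      (window_subset (unitStep_ne_zero i) R k l hwin).resolve_right fun h => hgood.1 h
    refine hx ⟨b * (R + R) + R, ?_, localTimes_at_new_site (unitStep_ne_zero i) (by omega)
      (fun r hr => ?_) htot⟩
    · have : (b + 1) * (R + R) ≤ m * (R + R) := Nat.mul_le_mul_right _ hb
      rw [add_mul, one_mul] at this
      omega
    · rcases lt_or_ge r (b * (R + R)) with hlt | hge
      · exact hold r hlt
      · obtain ⟨q, rfl⟩ := Nat.exists_eq_add_of_le hge
        have h := hnew q (Nat.zero_le _) (by omega)
        rw [pos_add, pos_add, add_assoc]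
        exact ⟨fun hc => h.1 (add_left_cancel hc), fun hc => h.2 (add_left_cancel hc)⟩
  refine (measureReal_mono hsub).trans ((measureReal_union_le _ _).trans (add_le_add ?_ ?_))
  · rw [(measure_no_success R e k l m).1]
    set p := (pathLaw d).real (success R e k l)
    have hp := le_measure_success hd i hu hsmall
    have hp1 : p ≤ 1 := measureReal_le_one
    calc (1 - p) ^ m ≤ Real.exp (-p) ^ m :=
          pow_le_pow_left₀ (by linarith) (by linarith [Real.add_one_le_exp (-p)]) m
      _ = Real.exp (-(m * p)) := by rw [← Real.exp_nat_mul]; ring_nf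
      _ ≤ _ := Real.exp_le_exp.2 (by
          have := mul_le_mul_of_nonneg_left hp (m.cast_nonneg (α := ℝ))
          rw [mul_left_comm]
          exact neg_le_neg this)
  · refine (measureReal_biUnion_finset_le _ _).trans ?_
    refine (Finset.sum_le_sum fun b _ => measure_spoiled_le hd i hu (b * (R + R))).trans ?_
    rw [Finset.sum_const, Finset.card_range, nsmul_eq_mul]
    exact le_of_eq (by ring)

end Blocks

/-! ### The lower bound -/

section LowerBound

variable {d : ℕ} [NeZero d]

/-- No site visited up to time `n` has local time `k + 1` while its neighbour in the direction `i`
has local time `l`. -/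
def missed (i : Fin d ⊕ Fin d) (k l n : ℕ) : Set (ℕ → Fin d ⊕ Fin d) :=
  {x | ¬∃ j ≤ n, localTime x (pos x j) = (k + 1 : ℕ) ∧
    localTime x (pos x j + unitStep d i) = (l : ℕ)}

/-- With `Y = n^η` all auxiliary quantities are powers of `Y`: counts at most `Y`, `s ≈ Y^64`, `u ≈
Y^(-16)`, and `m ≈ Y^8 / w` blocks. The spoiling term is then of order `Y^2 · Y^(-16) · Y^8 =
Y^(-6)`. The number `256` is merely generous. -/
lemma exists_measure_missed_le (hd : 3 ≤ d) {η : ℝ} (hη : 0 < η) (hη1 : 256 * η ≤ 1) :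
    ∃ (C : ℝ) (n₁ : ℕ), ∀ n : ℕ, n₁ ≤ n → ∀ (i : Fin d ⊕ Fin d) (k l : ℕ),
      pairRate (nextProb d) k l ≤ (1 - 256 * η) * Real.log n →
      (k : ℝ) + l + 1 ≤ (n : ℝ) ^ η ∧
        (pathLaw d).real (missed i k l n) ≤ C / ((n : ℝ) ^ η) ^ 6 := by
  obtain ⟨C₀, hC₀, hlate⟩ := exists_measure_late_visit_le hd
  set a := nextProb d
  have ha : 0 < a := nextProb_pos
  have ha1 : 2 * a < 1 := two_mul_nextProb_lt_one hd
  have hc₀ : 0 < -Real.log (2 * a) := neg_pos.2 (Real.log_neg (by positivity) ha1)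
  set c₀ := -Real.log (2 * a)
  set c := (1 - 2 * a) ^ 2 / 2
  have hd₁ : 0 < 1 - 2 * a := by linarith
  have hc : 0 < c := by positivity
  set c₁ := a * (1 - 2 * a) / 2
  have hc₁ : 0 < c₁ := by positivity
  set C₁ := 2 / a + 2
  have hC₁ : 0 < C₁ := by positivity
  have hX : Filter.Tendsto (fun n : ℕ => (n : ℝ) ^ η) Filter.atTop Filter.atTop :=
    (tendsto_rpow_atTop hη).comp tendsto_natCast_atTop_atTop
  have hlogX : ∀ᶠ n : ℕ in Filter.atTop, Real.log n ≤ c₀ / 2 * (n : ℝ) ^ η := by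
    have h := (isLittleO_log_rpow_atTop hη).bound (c := c₀ / 2) (by positivity)
    filter_upwards [tendsto_natCast_atTop_atTop.eventually h] with n hn
    refine (le_abs_self _).trans (hn.trans_eq ?_)
    rw [Real.norm_of_nonneg (by positivity)]
  have hX15 : Filter.Tendsto (fun n : ℕ => c₁ * ((n : ℝ) ^ η) ^ 15) Filter.atTop Filter.atTop :=
    ((Filter.tendsto_pow_atTop (by norm_num)).comp hX).const_mul_atTop hc₁
  obtain ⟨n₁, hn₁⟩ := Filter.eventually_atTop.1 (hlogX.and ((hX.eventually_ge_atTop 8).and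
    ((hX15.eventually_ge_atTop C₀).and (Filter.eventually_ge_atTop 1))))
  refine ⟨1 / c + 2 * C₁ * C₀, n₁, fun n hn i k l hkl => ?_⟩
  obtain ⟨hE1, hE2, hE3, hE4⟩ := hn₁ n hn
  have hn0 : (0 : ℝ) < n := Nat.cast_pos.2 hE4
  have hlog0 : 0 ≤ Real.log n := Real.log_natCast_nonneg n
  have hXpow : ((n : ℝ) ^ η) ^ 256 = (n : ℝ) ^ (256 * η) := by
    rw [← Real.rpow_natCast, ← Real.rpow_mul hn0.le, mul_comm]; norm_num
  set Y := (n : ℝ) ^ η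
  have hY0 : 0 < Y := by linarith
  have hY1 : 1 ≤ Y := by linarith
  have hL : (k : ℝ) + l + 1 ≤ Y := by
    have h1 := mul_add_le_pairRate ha k.cast_nonneg l.cast_nonneg
    have h2 : c₀ * (k + l) ≤ c₀ * (Y / 2) := by nlinarith
    have h3 := le_of_mul_le_mul_left h2 hc₀
    linarith
  have hL0 : (0 : ℝ) < k + l + 1 := by positivity
  refine ⟨hL, ?_⟩
  set w := pairWeight a k l
  have hw : 0 < w := pairWeight_pos ha k l
  have hw1 : w ≤ 1 := by
    refine (pairWeight_le_exp ha k l).trans (Real.exp_le_one_iff.2 ?_)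
    have h1 := mul_add_le_pairRate ha k.cast_nonneg l.cast_nonneg
    have : 0 ≤ c₀ * ((k : ℝ) + l) := by positivity
    linarith
  -- The rate assumption gives `exp (-rate) ≥ Y^256 / n`, and the polynomial correction costs at
  -- most `Y^4`.
  have hwn : Y ^ 252 ≤ w * n := by
    have h1 : Y ^ 256 / n ≤ Real.exp (-pairRate a k l) := by
      rw [hXpow, div_eq_mul_inv, ← Real.rpow_neg_one, ← Real.rpow_add hn0,
        Real.rpow_def_of_pos hn0]
      exact Real.exp_le_exp.2 (by linarith)
    have h2 := h1.trans (exp_le_pairWeight ha k l)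
    have h3 : ((k : ℝ) + l + 1) ^ 4 * w ≤ Y ^ 4 * w := by gcongr
    have h4 := h2.trans h3
    rw [div_le_iff₀ hn0] at h4
    have h5 : Y ^ 4 * Y ^ 252 ≤ Y ^ 4 * (w * n) := by
      rw [← pow_add, ← mul_assoc]
      exact h4
    exact le_of_mul_le_mul_left h5 (by positivity)
  -- The late-visit exponent `-1/4` turns this into `Y^(-16)`.
  set s := ⌈Y ^ 64⌉₊
  have hs1 : Y ^ 64 ≤ s := Nat.le_ceil _
  have hs2 : (s : ℝ) ≤ 2 * Y ^ 64 := by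
    have := Nat.ceil_lt_add_one (a := Y ^ 64) (by positivity)
    have : 1 ≤ Y ^ 64 := one_le_pow₀ hY1
    linarith
  have hs0 : 0 < s := Nat.ceil_pos.2 (by positivity)
  set m := ⌈Y ^ 8 / w⌉₊
  have hm1 : Y ^ 8 ≤ m * w := by
    rw [← div_le_iff₀ hw]; exact Nat.le_ceil _
  have hm2 : m * w ≤ 2 * Y ^ 8 := by
    have h1 := Nat.ceil_lt_add_one (a := Y ^ 8 / w) (by positivity)
    have h2 : 1 ≤ Y ^ 8 := one_le_pow₀ hY1
    have h3 : (m : ℝ) * w ≤ (Y ^ 8 / w + 1) * w := by gcongr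
    rw [add_mul, div_mul_cancel₀ _ hw.ne'] at h3
    linarith
  have hu : ∀ z : Fin d → ℤ, (pathLaw d).real {x | ∃ m, s < m ∧ pos x m = z} ≤ C₀ / Y ^ 16 := by
    intro z
    refine (hlate s z hs0).trans ?_
    rw [div_eq_mul_inv]
    refine mul_le_mul_of_nonneg_left ?_ hC₀.le
    refine (Real.rpow_le_rpow_of_nonpos (by positivity) hs1 (by norm_num)).trans (le_of_eq ?_)
    rw [← Real.rpow_natCast, ← Real.rpow_mul hY0.le, ← Real.rpow_natCast, ← Real.rpow_neg hY0.le]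
    norm_num
  have hsmall : ((k : ℝ) + l + 1) * (C₀ / Y ^ 16) ≤ c₁ := by
    calc ((k : ℝ) + l + 1) * (C₀ / Y ^ 16) ≤ Y * ((c₁ * Y ^ 15) / Y ^ 16) := by gcongr
      _ = c₁ := by field_simp
  -- After multiplication by `w` the blocks need at most `8 Y^73`, and `Y ≥ 8` absorbs the constant.
  have hfit : m * ((k + l + 1) * s + (k + l + 1) * s) ≤ n := by
    have h1 : (m : ℝ) * w * ((k + l + 1) * s) * 2 ≤ w * n := by
      calc (m : ℝ) * w * ((k + l + 1) * s) * 2 ≤ 2 * Y ^ 8 * (Y * (2 * Y ^ 64)) * 2 := by gcongr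
        _ = 8 * Y ^ 73 := by ring
        _ ≤ Y * Y ^ 73 := by gcongr
        _ = Y ^ 74 := by ring
        _ ≤ Y ^ 252 := pow_le_pow_right₀ hY1 (by norm_num)
        _ ≤ w * n := hwn
    have h2 : w * (m * ((k + l + 1) * s + (k + l + 1) * s)) ≤ w * n := by linarith
    exact_mod_cast le_of_mul_le_mul_left h2 hw
  refine (measure_forall_not_localTimes_le hd i hs0 hu hsmall hfit).trans ?_
  rw [add_div]
  refine add_le_add ?_ ?_
  · rw [Real.exp_neg, div_div, one_div]
    refine inv_anti₀ (by positivity) ?_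
    -- The crude `exp (-t) ≤ 1/t` is enough to match the order of the other term.
    have h1 : c * Y ^ 6 ≤ c * (m * w) :=
      mul_le_mul_of_nonneg_left ((pow_le_pow_right₀ hY1 (by norm_num)).trans hm1) hc.le
    linarith [Real.add_one_le_exp (c * (m * w))]
  · calc C₁ * (k + l + 1) ^ 2 * (C₀ / Y ^ 16) * (m * w)
        ≤ C₁ * Y ^ 2 * (C₀ / Y ^ 16) * (2 * Y ^ 8) := by gcongr
      _ = 2 * C₁ * C₀ / Y ^ 6 := by field_simp

/-- About `Y²` pairs, each missed with probability `O(Y^(-6))`, leave `O(Y^(-4))`. As a small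
negative power of `n` this need not be summable over all `n`, but along `n = 2^M` it is geometric.
-/
lemma ae_eventually_forall_not_missed_two_pow (hd : 3 ≤ d) {η : ℝ} (hη : 0 < η)
    (hη1 : 256 * η ≤ 1) :
    ∀ᵐ x ∂(pathLaw d), ∀ᶠ M : ℕ in Filter.atTop, ∀ (i : Fin d ⊕ Fin d) (k l : ℕ),
      pairRate (nextProb d) k l ≤ (1 - 256 * η) * Real.log (2 ^ M : ℕ) →
        x ∉ missed i k l (2 ^ M) := by
  obtain ⟨C, n₁, h⟩ := exists_measure_missed_le hd hη hη1
  let A : ℕ → Set (ℕ → Fin d ⊕ Fin d) := fun M => {x | ∃ (i : Fin d ⊕ Fin d) (k l : ℕ),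
    pairRate (nextProb d) k l ≤ (1 - 256 * η) * Real.log (2 ^ M : ℕ) ∧ x ∈ missed i k l (2 ^ M)}
  set Q : ℝ := (2 : ℝ) ^ η
  have hQ : 1 < Q := Real.one_lt_rpow (by norm_num) hη
  have hQ0 : 0 < Q := by linarith
  have hpow : ∀ M : ℕ, ((2 ^ M : ℕ) : ℝ) ^ η = Q ^ M := fun M => by
    push_cast
    rw [← Real.rpow_natCast, ← Real.rpow_mul (by norm_num), mul_comm, Real.rpow_mul (by norm_num),
      Real.rpow_natCast]
  have hmeas : ∀ M, n₁ ≤ M → (pathLaw d).real (A M) ≤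
      (2 * d * 4 * |C|) * ((Q ^ 4)⁻¹) ^ M := by
    intro M hM
    have hn : n₁ ≤ 2 ^ M := hM.trans Nat.lt_two_pow_self.le
    set Y := Q ^ M
    have hY1 : 1 ≤ Y := one_le_pow₀ hQ.le
    have hY0 : 0 < Y := by linarith
    set T := ⌊Y⌋₊ + 1
    have hT : (T : ℝ) ≤ 2 * Y := by
      have := Nat.floor_le hY0.le
      push_cast [T]
      linarith
    let S : Finset ((Fin d ⊕ Fin d) × ℕ × ℕ) :=
      Finset.univ ×ˢ (Finset.range T ×ˢ Finset.range T)
    let E : (Fin d ⊕ Fin d) × ℕ × ℕ → Set (ℕ → Fin d ⊕ Fin d) := fun p =>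
      {x | pairRate (nextProb d) p.2.1 p.2.2 ≤ (1 - 256 * η) * Real.log (2 ^ M : ℕ) ∧
        x ∈ missed p.1 p.2.1 p.2.2 (2 ^ M)}
    have hsub : A M ⊆ ⋃ p ∈ S, E p := by
      rintro x ⟨i, k, l, hkl, hx⟩
      have hL := (h (2 ^ M) hn i k l hkl).1
      rw [hpow] at hL
      have hk : k < T := Nat.lt_succ_of_le (Nat.le_floor (by linarith [l.cast_nonneg (α := ℝ)]))
      have hl : l < T := Nat.lt_succ_of_le (Nat.le_floor (by linarith [k.cast_nonneg (α := ℝ)]))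
      simp only [Set.mem_iUnion]
      exact ⟨(i, k, l), by simp [S, hk, hl], hkl, hx⟩
    have hE : ∀ p ∈ S, (pathLaw d).real (E p) ≤ |C| / Y ^ 6 := by
      rintro ⟨i, k, l⟩ _
      by_cases hkl : pairRate (nextProb d) k l ≤ (1 - 256 * η) * Real.log (2 ^ M : ℕ)
      · have h1 := (h (2 ^ M) hn i k l hkl).2
        rw [hpow] at h1
        refine (measureReal_mono fun x hx => hx.2).trans (h1.trans ?_)
        gcongr
        exact le_abs_self C
      · simp only [E, hkl, false_and, Set.ofPred_false, measureReal_empty]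
        positivity
    refine (measureReal_mono hsub (measure_ne_top _ _)).trans ((measureReal_biUnion_finset_le _ _).trans
      ((Finset.sum_le_sum hE).trans ?_))
    have hcard : (S.card : ℝ) ≤ 2 * d * (2 * Y) ^ 2 := by
      simp only [S, Finset.card_product, Finset.card_univ, Fintype.card_sum, Fintype.card_fin,
        Finset.card_range]
      push_cast
      calc ((d : ℝ) + d) * ((T : ℝ) * T) = 2 * d * (T : ℝ) ^ 2 := by ring
        _ ≤ 2 * d * (2 * Y) ^ 2 := by gcongr
    rw [Finset.sum_const, nsmul_eq_mul]
    calc (S.card : ℝ) * (|C| / Y ^ 6) ≤ 2 * d * (2 * Y) ^ 2 * (|C| / Y ^ 6) := by gcongr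
      _ = (2 * d * 4 * |C|) * (Y ^ 4)⁻¹ := by field_simp; ring
      _ = _ := by rw [inv_pow, ← pow_mul, ← pow_mul, mul_comm M 4]
  have hsum : Summable fun M : ℕ => (2 * d * 4 * |C|) * ((Q ^ 4)⁻¹) ^ M :=
    (summable_geometric_of_lt_one (by positivity)
      (inv_lt_one_of_one_lt₀ (one_lt_pow₀ hQ (by norm_num)))).mul_left _
  have hae := ae_eventually_notMem_of_summable (fun M => hmeas (M + n₁) (Nat.le_add_left _ _))
    ((summable_nat_add_iff n₁).2 hsum)
  filter_upwards [hae] with x hx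
  obtain ⟨N, hN⟩ := Filter.eventually_atTop.1 hx
  refine Filter.eventually_atTop.2 ⟨N + n₁, fun M hM i k l hkl hmem => ?_⟩
  have := hN (M - n₁) (by omega)
  rw [Nat.sub_add_cancel (by omega)] at this
  exact this ⟨i, k, l, hkl, hmem⟩

/-- All pairs of local times allowed by the lower bound eventually occur up to time `n`. -/
theorem ae_exists_localTimes (hd : 3 ≤ d) {ε : ℝ} (hε : 0 < ε) (hε1 : ε ≤ 1) :
    ∀ᵐ x ∂(pathLaw d), ∃ n₀ : ℕ, ∀ n : ℕ, n₀ ≤ n → ∀ k l : ℕ,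
      pairRate (nextProb d) k l ≤ (1 - ε) * Real.log n → ∀ i : Fin d ⊕ Fin d, ∃ j ≤ n,
        localTime x (pos x j) = (k + 1 : ℕ) ∧
          localTime x (pos x j + unitStep d i) = (l : ℕ) := by
  -- Then `256 η = ε/2`; the other half of `ε` pays for replacing `n` by the power of two below it.
  filter_upwards [ae_eventually_forall_not_missed_two_pow hd (η := ε / 512) (by positivity)
    (by linarith)] with x hx
  obtain ⟨M₀, hM₀⟩ := Filter.eventually_atTop.1 hx
  refine ⟨2 ^ (max M₀ ⌈2 / ε⌉₊), fun n hn k l hkl i => ?_⟩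
  have hn0 : n ≠ 0 := (lt_of_lt_of_le (by positivity) hn).ne'
  set M := Nat.log 2 n
  have hM : max M₀ ⌈2 / ε⌉₊ ≤ M := Nat.le_log_of_pow_le (by norm_num) hn
  have hMn : 2 ^ M ≤ n := Nat.pow_log_le_self 2 hn0
  have hnM : n ≤ 2 ^ (M + 1) := (Nat.lt_pow_succ_log_self (by norm_num) n).le
  -- Ensures `(1-ε)(M+1) ≤ (1-ε/2)M`, so the rate condition at `n` implies the one at `2^M`.
  have hMε : 2 ≤ ε * M := by
    have h1 : 2 / ε ≤ M :=
      (Nat.le_ceil _).trans (Nat.cast_le.2 ((le_max_right M₀ _).trans hM))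
    rwa [div_le_iff₀ hε, mul_comm] at h1
  have hlog : Real.log n ≤ (M + 1) * Real.log 2 := by
    have h1 : Real.log n ≤ Real.log ((2 : ℝ) ^ (M + 1)) :=
      Real.log_le_log (by positivity) (by exact_mod_cast hnM)
    rw [Real.log_pow] at h1
    exact_mod_cast h1
  have hlog2 : 0 < Real.log 2 := Real.log_pos (by norm_num)
  have hkl' : pairRate (nextProb d) k l ≤ (1 - 256 * (ε / 512)) * Real.log (2 ^ M : ℕ) := by
    refine hkl.trans ?_
    push_cast
    rw [Real.log_pow, ← mul_assoc]
    calc (1 - ε) * Real.log n ≤ (1 - ε) * ((M + 1) * Real.log 2) :=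
          mul_le_mul_of_nonneg_left hlog (by linarith)
      _ = ((1 - ε) * (M + 1)) * Real.log 2 := by ring
      _ ≤ _ := mul_le_mul_of_nonneg_right (by nlinarith) hlog2.le
  have hnot := hM₀ M ((le_max_left _ _).trans hM) i k l hkl'
  rw [missed, Set.mem_ofPred_eq, not_not] at hnot
  obtain ⟨j, hj, h⟩ := hnot
  exact ⟨j, hj.trans hMn, h⟩

end LowerBound

/-! ### Transfer from the canonical space to the given walk -/

section Transfer

variable {d : ℕ}

lemma walk_eq_pos {Ω : Type*} {X : ℕ → Ω → Fin d → ℤ} {ω : Ω} {x : ℕ → Fin d ⊕ Fin d}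
    (h : ∀ k, X k ω = unitStep d (x k)) (n : ℕ) : walk X n ω = pos x n :=
  Finset.sum_congr rfl fun k _ => h k

lemma totalLocalTime_eq {Ω : Type*} {X : ℕ → Ω → Fin d → ℤ} {ω : Ω} {x : ℕ → Fin d ⊕ Fin d}
    (h : ∀ k, X k ω = unitStep d (x k)) (z : Fin d → ℤ) :
    totalLocalTime X z ω = localTime x z := by
  simp only [totalLocalTime, localTime, walk_eq_pos h]

variable [NeZero d]

/-- The step sequence of the walk is almost surely given by step labels with the canonical law. -/
lemma exists_labels {Ω : Type*} [MeasurableSpace Ω] {μ : Measure Ω} [IsProbabilityMeasure μ]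
    {X : ℕ → Ω → Fin d → ℤ} (hX : IsSimpleSteps d μ X) :
    ∃ L : Ω → ℕ → Fin d ⊕ Fin d, Measurable L ∧ μ.map L = pathLaw d ∧
      ∀ᵐ ω ∂μ, ∀ k, X k ω = unitStep d (L ω k) := by
  have : Nonempty (Fin d ⊕ Fin d) := ⟨Sum.inl ⟨0, NeZero.pos d⟩⟩
  let g : (Fin d → ℤ) → Fin d ⊕ Fin d := Function.invFun (unitStep d)
  have hg : ∀ i, g (unitStep d i) = i := Function.leftInverse_invFun (unitStep_injective d)
  have hgm : Measurable g := .of_discrete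
  have hXm : Measurable fun ω k => X k ω := measurable_pi_lambda _ hX.measurable
  have hU : Measurable fun (x : ℕ → Fin d ⊕ Fin d) k => unitStep d (x k) :=
    measurable_pi_lambda _ fun k => (Measurable.of_discrete (f := unitStep d)).comp
      (measurable_pi_apply k)
  have hG : Measurable fun (y : ℕ → Fin d → ℤ) k => g (y k) :=
    measurable_pi_lambda _ fun k => hgm.comp (measurable_pi_apply k)
  refine ⟨fun ω k => g (X k ω), hG.comp hXm, ?_, ?_⟩
  · have h := congrArg (Measure.map fun (y : ℕ → Fin d → ℤ) k => g (y k)) (map_steps_eq hX)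
    rw [Measure.map_map hG hXm, Measure.map_map hG hU] at h
    simp only [Function.comp_def, hg] at h
    rw [h]
    exact Measure.map_id
  · refine ae_all_iff.2 fun k => ?_
    have h : ∀ᵐ y ∂μ.map (X k), y = unitStep d (g y) := by
      rw [map_unitStep_eq hX, ae_map_iff Measurable.of_discrete.aemeasurable
        (Set.to_countable _).measurableSet]
      exact Filter.Eventually.of_forall fun i => by rw [hg]
    exact ae_of_ae_map (hX.measurable k).aemeasurable h

lemma escapeProb_eq {Ω : Type*} [MeasurableSpace Ω] {μ : Measure Ω} [IsProbabilityMeasure μ]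
    {X : ℕ → Ω → Fin d → ℤ} (hX : IsSimpleSteps d μ X) : escapeProb μ X = escape d := by
  obtain ⟨L, hL, hlaw, hXL⟩ := exists_labels hX
  have hm : MeasurableSet {x : ℕ → Fin d ⊕ Fin d | ∀ k, 0 < k → pos x k ≠ 0} := by
    have := (measurableSet_hitting (0 : Fin d → ℤ)).compl
    convert this using 1
    ext x; simp [hitting]
  rw [escape, ← hlaw, map_measureReal_apply hL hm, escapeProb]
  refine measureReal_congr ?_
  filter_upwards [hXL] with ω hω
  refine propext (forall₂_congr fun k _ => ?_)
  rw [walk_eq_pos hω]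

end Transfer

end LatticeWalk

/-! ### Conclusion: both bounds on one almost sure event -/

theorem theorem1p2 {Ω : Type*} [MeasurableSpace Ω] (μ : Measure Ω) [IsProbabilityMeasure μ]
    (d : ℕ) (hd : 3 ≤ d) (X : ℕ → Ω → (Fin d → ℤ)) (hX : LatticeWalk.IsSimpleSteps d μ X)
    (ε : ℝ) (hε : 0 < ε) :
    ∀ᵐ ω ∂μ, ∃ n₀ : ℕ, ∀ n : ℕ, n₀ ≤ n →
      (∀ j : ℕ, j ≤ n → ∀ i : Fin d ⊕ Fin d, ∃ a b : ℕ,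
        LatticeWalk.totalLocalTime X (LatticeWalk.walk X j ω) ω = (a : ℕ∞) ∧
        LatticeWalk.totalLocalTime X
          (LatticeWalk.walk X j ω + LatticeWalk.unitStep d i) ω = (b : ℕ∞) ∧
        ((a : ℝ), (b : ℝ)) ∈
          ((1 + ε) * Real.log n) • LatticeWalk.regionB (LatticeWalk.escapeProb μ X)) ∧
      (∀ k l : ℕ,
        ((k : ℝ), (l : ℝ)) ∈
          ((1 - ε) * Real.log n) • LatticeWalk.regionB (LatticeWalk.escapeProb μ X) →
        ∀ i : Fin d ⊕ Fin d, ∃ j : ℕ, j ≤ n ∧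
          LatticeWalk.totalLocalTime X (LatticeWalk.walk X j ω) ω = ((k + 1 : ℕ) : ℕ∞) ∧
          LatticeWalk.totalLocalTime X
            (LatticeWalk.walk X j ω + LatticeWalk.unitStep d i) ω = (l : ℕ∞)) := by
  have : NeZero d := ⟨by omega⟩
  obtain ⟨L, hL, hlaw, hXL⟩ := LatticeWalk.exists_labels hX
  have hγ := LatticeWalk.escapeProb_eq hX
  have hupper : ∀ᵐ ω ∂μ, _ := ae_of_ae_map hL.aemeasurable
    (hlaw ▸ LatticeWalk.ae_localTime_rate_le (d := d) hd hε)
  have hlower : ∀ᵐ ω ∂μ, _ := ae_of_ae_map hL.aemeasurable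
    (hlaw ▸ LatticeWalk.ae_exists_localTimes (d := d) hd (ε := min ε 1)
      (lt_min hε one_pos) (min_le_right _ _))
  filter_upwards [hXL, hupper, hlower] with ω hω hup hlow
  obtain ⟨n₁, hn₁⟩ := hup
  obtain ⟨n₂, hn₂⟩ := hlow
  refine ⟨max 2 (max n₁ n₂), fun n hn => ?_⟩
  have h2 : 2 ≤ n := (le_max_left _ _).trans hn
  have h1n : n₁ ≤ n := (le_max_left _ _).trans ((le_max_right _ _).trans hn)
  have h2n : n₂ ≤ n := (le_max_right _ _).trans ((le_max_right _ _).trans hn)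
  have hlog : 0 < Real.log n := Real.log_pos (by exact_mod_cast h2)
  simp only [LatticeWalk.totalLocalTime_eq hω, LatticeWalk.walk_eq_pos hω, hγ]
  refine ⟨fun j hj i => ?_, fun k l hkl i => ?_⟩
  · obtain ⟨a, b, ha, hb, hab⟩ := hn₁ n h1n j hj i
    exact ⟨a, b, ha, hb, (LatticeWalk.mem_smul_regionB (by positivity)).2
      ⟨a.cast_nonneg, b.cast_nonneg, hab⟩⟩
  · refine hn₂ n h2n k l ?_ i
    have hmin : 0 ≤ (1 - min ε 1) * Real.log n :=
      mul_nonneg (by linarith [min_le_right ε 1]) hlog.le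
    -- For `ε ≥ 1` the dilation factor is not positive, so the dilate contains no pair of natural
    -- numbers other than `(0, 0)`. That pair has rate zero and is covered by the lower bound with
    -- `min ε 1`.
    rcases le_or_gt ((1 - ε) * Real.log n) 0 with hc | hc
    · obtain ⟨rfl, rfl⟩ := LatticeWalk.eq_zero_of_mem_smul_regionB hc hkl
      simpa [LatticeWalk.pairRate] using hmin
    · refine ((LatticeWalk.mem_smul_regionB hc).1 hkl).2.2.trans ?_
      exact mul_le_mul_of_nonneg_right (by linarith [min_le_left ε 1]) hlog.le
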